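/- Notation. For $d\in\{1,2\}$ let $\mathcal F^{(d)}$ be the Fourier transform on $L_2(\mathbb R^d)$ (complex-valued functions) with kernel $e^{-i\langle x,t\rangle}$, and let $$PW^{(d)}=\{f\in L_2(\mathbb R^d): \mathcal F^{(d)}[f]=0 \text{ a.e. outside } [-\pi,\pi]^d\},\qquad PW=PW^{(1)},$$ where each $f\in PW^{(d)}$ is identified with its continuous representative $f(t)=(2\pi)^{-d}\int_{[-\pi,\pi]^d}\mathcal F^{(d)}[f](\xi)\,e^{i\langle \xi,t\rangle}\,d\xi$. A sequence $(x_j)_{j\in\mathbb Z}$ of real numbers is a Riesz-basis sequence if it is strictly increasing and the functions $t\mapsto e^{-ix_jt}$ form a Riesz basis of $L_2[-\pi,\pi]$, i.e. every $h\in L_2[-\pi,\pi]$ has a unique expansion $h=\sum_j a_je^{-ix_j\cdot}$ with $\sum_j|a_j|^2<\infty$, and for some $B>0$ one has $B^{-1}\|c\|_{\ell_2}\le\|\sum_j c_je^{-ix_j\cdot}\|\le B\|c\|_{\ell_2}$ for all $c\in\ell_2(\mathbb Z)$. For $\lambda>0$ and nodes $(w_k)_{k}\subset\mathbb R^d$,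 the Gaussian interpolation operator is the bounded linear operator $PW^{(d)}\to L_2(\mathbb R^d)$ sending $f$ to $\sum_j a_j e^{-\lambda\|\cdot-w_j\|^2}$, where $(a_j)$ is the unique square-summable sequence with $\sum_j a_je^{-\lambda\|w_k-w_j\|^2}=f(w_k)$ for all $k$. For Hilbert spaces $H,K$, $H\otimes_h K$ is the completion of $H\otimes K$ for the inner product with $\langle h_1\otimes k_1,h_2\otimes k_2\rangle=\langle h_1,h_2\rangle\langle k_1,k_2\rangle$, and $S\otimes_h T$ is the bounded extension of $S\otimes T$ for bounded operators $S,T$. Proposition. Let $(x_j)_{j\in\mathbb Z}$ and $(y_j)_{j\in\mathbb Z}$ be Riesz-basis sequences and $\lambda>0$. Then the one-dimensional Gaussian interpolation operators $I_\lambda$ for $(x_j)$ and $I'_\lambda$ for $(y_j)$, and the two-dimensional Gaussian interpolation operator $I^{(2)}_\lambda$ for the grid $z_{(l,k)}=(x_l,y_k)$, $l,k\in\mathbb Z$, are well defined and bounded. The assignments $f\otimes h\mapsto\big((s,t)\mapsto f(s)h(t)\big)$ extend to isometric isomorphisms $\Phi: PW\otimes_h PW\to PW^{(2)}$ and $\Psi: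 L_2(\mathbb R)\otimes_h L_2(\mathbb R)\to L_2(\mathbb R^2)$, and under these identifications $$I^{(2)}_\lambda=I_\lambda\otimes_h I'_\lambda,$$ that is, $I^{(2)}_\lambda=\Psi\circ(I_\lambda\otimes_h I'_\lambda)\circ\Phi^{-1}$ as operators from $PW^{(2)}$ to $L_2(\mathbb R^2)$. -/

import Mathlib

open MeasureTheory Set
open scoped FourierTransform TensorProduct ENNReal

noncomputable section

namespace GaussianInterpolation

/-! ### Riesz bases and Riesz-basis sequences -/

/-- A family `φ` in a Hilbert space is a Riesz basis if every vector has a unique expansion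
`∑ j, a j • φ j` with square-summable coefficients, and `B⁻¹ ‖c‖ ≤ ‖∑ j, c j • φ j‖ ≤ B ‖c‖` for
all square-summable `c` and some constant `B`. -/
def IsRieszBasis {ι H : Type*} [NormedAddCommGroup H] [InnerProductSpace ℂ H] (φ : ι → H) : Prop :=
  (∀ h : H, ∃! a : lp (fun _ : ι => ℂ) 2, HasSum (fun j => a j • φ j) h) ∧
    ∃ B : ℝ, 0 < B ∧ ∀ c : lp (fun _ : ι => ℂ) 2,
      Summable (fun j => c j • φ j) ∧
        B⁻¹ * ‖c‖ ≤ ‖∑' j, c j • φ j‖ ∧ ‖∑' j, c j • φ j‖ ≤ B * ‖c‖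

theorem memLp_expFun (s : ℝ) :
    MemLp (fun t : ℝ => Complex.exp (-(Complex.I * (s * t : ℝ)))) 2
      (volume.restrict (Icc (-Real.pi) Real.pi)) := by
  refine MemLp.of_bound (Continuous.aestronglyMeasurable (by fun_prop)) 1
    (Filter.Eventually.of_forall fun t => ?_)
  have h : -(Complex.I * ((s * t : ℝ) : ℂ)) = ((-(s * t) : ℝ) : ℂ) * Complex.I := by
    push_cast; ring
  rw [h, Complex.norm_exp_ofReal_mul_I]

/-- The function `t ↦ exp (-i s t)` as an element of `L²[-π, π]`. -/
def expFun (s : ℝ) : Lp ℂ 2 (volume.restrict (Icc (-Real.pi) Real.pi)) :=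
  (memLp_expFun s).toLp _

/-- A Riesz-basis sequence: strictly increasing real numbers `x j` (`j ∈ ℤ`) for which the
functions `t ↦ exp (-i (x j) t)` form a Riesz basis of `L²[-π, π]`. -/
def IsRieszBasisSequence (x : ℤ → ℝ) : Prop :=
  (∀ j : ℤ, x j < x (j + 1)) ∧ IsRieszBasis fun j => expFun (x j)

/-! ### Paley-Wiener spaces -/

section PaleyWiener

variable {E : Type*} [NormedAddCommGroup E] [InnerProductSpace ℝ E] [FiniteDimensional ℝ E]
  [MeasurableSpace E] [BorelSpace E]

/-- The Fourier transform with kernel `exp (-i ⟪ξ, t⟫)` of an `L²` function. Mathlib's `𝓕` is the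
`L²` Fourier transform with kernel `exp (-2 π i ⟪ξ, t⟫)`. -/
def angularFourier (f : Lp (α := E) ℂ 2 volume) (ξ : E) : ℂ :=
  (𝓕 f : Lp (α := E) ℂ 2 volume) ((2 * Real.pi)⁻¹ • ξ)

theorem ae_smul_iff (p : E → Prop) (hp : ∀ᵐ ξ : E, p ξ) :
    ∀ᵐ ξ : E, p ((2 * Real.pi)⁻¹ • ξ) := by
  have hc : ((2 * Real.pi)⁻¹ : ℝ) ≠ 0 := by positivity
  have hq : Measure.QuasiMeasurePreserving (fun ξ : E => (2 * Real.pi)⁻¹ • ξ) volume volume := by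
    refine ⟨measurable_const_smul _, ?_⟩
    rw [Measure.map_addHaar_smul volume hc]
    exact Measure.AbsolutelyContinuous.smul_left Measure.AbsolutelyContinuous.rfl _
  exact hq.ae hp

/-- The functions in `L²(E)` whose Fourier transform vanishes almost everywhere outside `K`. -/
def paleyWiener (K : Set E) : Submodule ℂ (Lp (α := E) ℂ 2 volume) where
  carrier := {f | ∀ᵐ ξ : E, ξ ∉ K → angularFourier f ξ = 0}
  zero_mem' := by
    have h0 : (𝓕 (0 : Lp (α := E) ℂ 2 volume) : Lp (α := E) ℂ 2 volume) = 0 :=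
      (Lp.fourierTransformₗᵢ E ℂ).map_zero
    have h := ae_smul_iff _ (Lp.coeFn_zero ℂ 2 (volume : Measure E))
    show ∀ᵐ ξ : E, _
    filter_upwards [h] with ξ hξ _
    simp only [angularFourier, h0]
    exact hξ
  add_mem' := by
    intro f g hf hg
    have h := ae_smul_iff _ (Lp.coeFn_add (𝓕 f : Lp (α := E) ℂ 2 volume) (𝓕 g))
    show ∀ᵐ ξ : E, _
    filter_upwards [h, hf, hg] with ξ hξ h1 h2 hK
    have h1' := h1 hK
    have h2' := h2 hK
    simp only [angularFourier] at h1' h2' ⊢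
    rw [FourierTransform.fourier_add, hξ, Pi.add_apply, h1', h2', add_zero]
  smul_mem' := by
    intro c f hf
    have h := ae_smul_iff _ (Lp.coeFn_smul c (𝓕 f : Lp (α := E) ℂ 2 volume))
    show ∀ᵐ ξ : E, _
    filter_upwards [h, hf] with ξ hξ h1 hK
    have h1' := h1 hK
    simp only [angularFourier] at h1' ⊢
    rw [FourierTransform.fourier_smul, hξ, Pi.smul_apply, h1', smul_zero]

/-- The value at the point `t` of (the continuous representative of) `f ∈ PW`, given by Fourier
inversion: `f t = (2π)^{-d} ∫_K (angularFourier f ξ) exp (i ⟪ξ, t⟫) dξ`, with `d = dim E`. -/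
def pointValue {K : Set E} (f : paleyWiener K) (t : E) : ℂ :=
  ((2 * Real.pi) ^ Module.finrank ℝ E : ℝ)⁻¹ •
    ∫ ξ in K, angularFourier (f : Lp (α := E) ℂ 2 volume) ξ *
      Complex.exp (Complex.I * (inner ℝ ξ t : ℝ))

/-! ### Gaussian interpolation operators -/

/-- The Gaussian `g_λ(t) = exp (-λ ‖t‖²)`. -/
def gaussian (lam : ℝ) (t : E) : ℂ := (Real.exp (-lam * ‖t‖ ^ 2) : ℝ)

/-- The coefficients `a` solve the interpolation problem for `f` at the nodes `x`, i.e.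
`∑ j, a j * g_λ (x k - x j) = f (x k)` for all `k`. -/
def Interpolates {ι : Type*} {K : Set E} (lam : ℝ) (x : ι → E) (f : paleyWiener K)
    (a : lp (fun _ : ι => ℂ) 2) : Prop :=
  ∀ k, HasSum (fun j => a j * gaussian lam (x k - x j)) (pointValue f (x k))

/-- The bounded operator `T : PW → L²` is the Gaussian interpolation operator for `λ` and the
nodes `x`: for every `f ∈ PW` there is exactly one square-summable solution `a` of the
interpolation problem, and `T f = ∑ j, a j * g_λ (· - x j)`. -/
def IsGaussianInterpolationOperator {ι : Type*} (K : Set E) (lam : ℝ) (x : ι → E)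
    (T : paleyWiener K →L[ℂ] Lp (α := E) ℂ 2 volume) : Prop :=
  ∀ f : paleyWiener K,
    (∃! a : lp (fun _ : ι => ℂ) 2, Interpolates lam x f a) ∧
      ∀ a : lp (fun _ : ι => ℂ) 2, Interpolates lam x f a →
        ∀ᵐ t : E, HasSum (fun j => a j * gaussian lam (t - x j)) (T f t)

open scoped Classical in
/-- The Gaussian interpolation operator `PW → L²` for `λ` and the nodes `x` (and the zero operator
should the interpolation problem not define a bounded operator). -/
def gaussianInterpolationOperator {ι : Type*} (K : Set E) (lam : ℝ) (x : ι → E) :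
    paleyWiener K →L[ℂ] Lp (α := E) ℂ 2 volume :=
  if h : ∃ T, IsGaussianInterpolationOperator K lam x T then h.choose else 0

end PaleyWiener

/-- The interval `[-π, π]`. -/
def band : Set ℝ := Icc (-Real.pi) Real.pi

/-- The square `[-π, π]²`. -/
def band₂ : Set (EuclideanSpace ℝ (Fin 2)) := {ξ | ∀ i, ξ i ∈ Icc (-Real.pi) Real.pi}

/-- The grid `z (l, k) = (x l, y k)` in the plane. -/
def grid (x y : ℤ → ℝ) (p : ℤ × ℤ) : EuclideanSpace ℝ (Fin 2) := !₂[x p.1, y p.2]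

/-! ### Hilbert tensor products -/

section HilbertTensor

variable (H K V W : Type*)
  [NormedAddCommGroup H] [InnerProductSpace ℂ H] [NormedAddCommGroup K] [InnerProductSpace ℂ K]
  [NormedAddCommGroup V] [InnerProductSpace ℂ V] [NormedAddCommGroup W] [InnerProductSpace ℂ W]

/-- The Hilbert tensor product `H ⊗ₕ K`: the completion of the algebraic tensor product for the
inner product with `⟪h₁ ⊗ k₁, h₂ ⊗ k₂⟫ = ⟪h₁, h₂⟫ ⟪k₁, k₂⟫`. -/
abbrev HilbertTensor : Type _ := UniformSpace.Completion (H ⊗[ℂ] K)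

variable {H K V W}

/-- The elementary tensor `h ⊗ k` in `H ⊗ₕ K`. -/
def pureTensor (h : H) (k : K) : HilbertTensor H K := ((h ⊗ₜ[ℂ] k : H ⊗[ℂ] K) : HilbertTensor H K)

/-- The tensor product `S ⊗ₕ T : H ⊗ₕ K → V ⊗ₕ W` of two bounded operators: the continuous extension
of the algebraic tensor product of the operators. -/
def hilbertTensorMap (S : H →L[ℂ] V) (T : K →L[ℂ] W) :
    HilbertTensor H K →L[ℂ] HilbertTensor V W :=
  ((UniformSpace.Completion.toComplL (𝕜 := ℂ) (E := V ⊗[ℂ] W)).comp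
    (TensorProduct.mapL S T)).extend (UniformSpace.Completion.toComplL (𝕜 := ℂ) (E := H ⊗[ℂ] K))

theorem hilbertTensorMap_coe (S : H →L[ℂ] V) (T : K →L[ℂ] W) (u : H ⊗[ℂ] K) :
    hilbertTensorMap S T (u : HilbertTensor H K) =
      ((TensorProduct.map S.toLinearMap T.toLinearMap u : V ⊗[ℂ] W) : HilbertTensor V W) := by
  have h := ContinuousLinearMap.extend_eq
    (e := UniformSpace.Completion.toComplL (𝕜 := ℂ) (E := H ⊗[ℂ] K))
    ((UniformSpace.Completion.toComplL (𝕜 := ℂ) (E := V ⊗[ℂ] W)).comp (TensorProduct.mapL S T))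
    UniformSpace.Completion.denseRange_coe (UniformSpace.Completion.isUniformInducing_coe _) u
  rw [ContinuousLinearMap.comp_apply, TensorProduct.mapL_apply] at h
  exact h

end HilbertTensor

end GaussianInterpolation

end

open GaussianInterpolation

/-! In any dimension the interpolation operator factors as `S ∘ A⁻¹ ∘ P`: `P` samples a band-limited
function at the nodes, `A` is the Gaussian matrix acting on `ℓ²`, and `S` sums Gaussian translates.
`isGaussianInterpolationOperator_comp` shows that bounded `P`, `S` and a boundedly invertible `A`
are enough, together with square-summable Gaussian values at each point.

On the line, the lower Riesz bound separates the nodes, so Schur's test bounds the Gram matrices of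
Gaussian type. `P` is, up to the Fourier transform, the adjoint of a synthesis operator for
exponentials on the band. Up to a constant, `A` is the Gram matrix `T* T` of exponentials damped by
a Gaussian; the damping is bounded below on `[-π, π]`, so the lower Riesz bound makes `T* T`
coercive.

For a grid, everything splits. The Gaussian is a product because squared Euclidean norms add, point
evaluation on `PW⁽²⁾` is a product because the Fourier kernel is, and `ℓ²(ℤ) ⊗ₕ ℓ²(ℤ)` is `ℓ²(ℤ ×
ℤ)`. Hence the planar sampling, matrix and synthesis are Hilbert tensor products of the linear ones,
and so is the composite, by functoriality. The identification with the planar operator follows from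
uniqueness. The maps `Φ` and `Ψ` exist because product functions multiply inner products and are
total, which for `PW⁽²⁾` is checked on the Fourier side. -/

noncomputable section

namespace GaussianInterpolation

/-! ### Hilbert tensor products and their concrete models -/

section HilbertTensor

variable {H K L V W : Type*}
  [NormedAddCommGroup H] [InnerProductSpace ℂ H] [NormedAddCommGroup K] [InnerProductSpace ℂ K]
  [NormedAddCommGroup L] [InnerProductSpace ℂ L]
  [NormedAddCommGroup V] [InnerProductSpace ℂ V] [NormedAddCommGroup W] [InnerProductSpace ℂ W]

theorem hilbertTensorMap_pureTensor (S : H →L[ℂ] V) (T : K →L[ℂ] W) (h : H) (k : K) :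
    hilbertTensorMap S T (pureTensor h k) = pureTensor (S h) (T k) := by
  rw [pureTensor, hilbertTensorMap_coe, TensorProduct.map_tmul]
  rfl

/-- Continuous linear maps on a Hilbert tensor product are determined by the elementary tensors. -/
theorem hilbertTensor_ext {M : Type*} [NormedAddCommGroup M] [NormedSpace ℂ M]
    {f g : HilbertTensor H K →L[ℂ] M}
    (hfg : ∀ h k, f (pureTensor h k) = g (pureTensor h k)) : f = g := by
  ext u
  refine UniformSpace.Completion.induction_on u (isClosed_eq f.continuous g.continuous) fun v => ?_
  have : f.toLinearMap ∘ₗ (UniformSpace.Completion.toComplL (𝕜 := ℂ) (E := H ⊗[ℂ] K)).toLinearMap =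
      g.toLinearMap ∘ₗ (UniformSpace.Completion.toComplL (𝕜 := ℂ) (E := H ⊗[ℂ] K)).toLinearMap :=
    TensorProduct.ext' hfg
  exact LinearMap.congr_fun this v

/-- Both sides are sesquilinear, so elementary tensors suffice. This makes the lift of `β`
isometric. -/
theorem inner_lift_bilinear (β : H →ₗ[ℂ] K →ₗ[ℂ] L)
    (hβ : ∀ h k h' k', inner ℂ (β h k) (β h' k') = inner ℂ h h' * inner ℂ k k')
    (u v : H ⊗[ℂ] K) :
    inner ℂ (TensorProduct.lift β u) (TensorProduct.lift β v) = inner ℂ u v := by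
  induction u with
  | zero => simp
  | add a b ha hb => rw [map_add, inner_add_left, inner_add_left, ha, hb]
  | tmul h k =>
    induction v with
    | zero => simp
    | add a b ha hb => rw [map_add, inner_add_right, inner_add_right, ha, hb]
    | tmul h' k' => simp [hβ]

/-- A bilinear map that multiplies inner products and has total range identifies its codomain with
the Hilbert tensor product. -/
theorem exists_hilbertTensor_equiv [CompleteSpace L] (β : H →ₗ[ℂ] K →ₗ[ℂ] L)
    (hβ : ∀ h k h' k', inner ℂ (β h k) (β h' k') = inner ℂ h h' * inner ℂ k k')
    (htotal : ∀ v : L, (∀ h k, inner ℂ (β h k) v = 0) → v = 0) :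
    ∃ e : HilbertTensor H K ≃ₗᵢ[ℂ] L, ∀ h k, e (pureTensor h k) = β h k := by
  have hnorm : ∀ u : H ⊗[ℂ] K, ‖TensorProduct.lift β u‖ = ‖u‖ := fun u => by
    rw [@norm_eq_sqrt_re_inner ℂ, @norm_eq_sqrt_re_inner ℂ, inner_lift_bilinear β hβ]
  let j : H ⊗[ℂ] K →ₗᵢ[ℂ] L := ⟨TensorProduct.lift β, hnorm⟩
  have hdense : DenseRange j := by
    have htop : (LinearMap.range j.toLinearMap).topologicalClosure = ⊤ := by
      rw [Submodule.topologicalClosure_eq_top_iff, Submodule.eq_bot_iff]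
      intro v hv
      refine htotal v fun h k => ?_
      exact (Submodule.mem_orthogonal _ _).1 hv _ ⟨h ⊗ₜ k, TensorProduct.lift.tmul h k⟩
    have := (Submodule.dense_iff_topologicalClosure_eq_top).2 htop
    exact this
  have hnorm' : ∀ u : H ⊗[ℂ] K, ‖j.toLinearMap (LinearEquiv.refl ℂ (H ⊗[ℂ] K) u)‖ =
      ‖(UniformSpace.Completion.toComplL (𝕜 := ℂ) (E := H ⊗[ℂ] K)).toLinearMap u‖ := fun u =>
    (j.norm_map u).trans (UniformSpace.Completion.norm_coe u).symm
  refine ⟨(LinearEquiv.refl ℂ (H ⊗[ℂ] K)).extendOfIsometry _ _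
    UniformSpace.Completion.denseRange_coe hdense hnorm', fun h k => ?_⟩
  exact (LinearEquiv.extendOfIsometry_eq _ _ _ UniformSpace.Completion.denseRange_coe hdense
    hnorm' (h ⊗ₜ k)).trans (TensorProduct.lift.tmul h k)

end HilbertTensor

/-! ### Synthesis operators on `ℓ²` -/

section Synthesis

variable {ι H : Type*} [NormedAddCommGroup H] [InnerProductSpace ℂ H]

theorem hasSum_norm_sq (a : lp (fun _ : ι => ℂ) 2) : HasSum (fun j => ‖a j‖ ^ 2) (‖a‖ ^ 2) := by
  simpa using lp.hasSum_norm (p := 2) (by norm_num) a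

variable [DecidableEq ι]

theorem hasSum_smul_single (a : lp (fun _ : ι => ℂ) 2) :
    HasSum (fun j => a j • lp.single (E := fun _ : ι => ℂ) 2 j (1 : ℂ)) a := by
  have := lp.hasSum_single (by norm_num) a
  convert this using 2 with j
  rw [← lp.single_smul, smul_eq_mul, mul_one]

/-- A continuous linear map on `ℓ²` is the sum of its values on the unit vectors. -/
theorem hasSum_map_single {M : Type*} [NormedAddCommGroup M] [NormedSpace ℂ M]
    (T : lp (fun _ : ι => ℂ) 2 →L[ℂ] M) (a : lp (fun _ : ι => ℂ) 2) :
    HasSum (fun j => a j • T (lp.single 2 j 1)) (T a) := by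
  simpa using (hasSum_smul_single a).mapL T

/-- A family satisfying an upper Riesz bound has a bounded synthesis operator. -/
theorem exists_synthesis [CompleteSpace H] (v : ι → H) (C : ℝ)
    (hC : ∀ (s : Finset ι) (a : ι → ℂ), ‖∑ j ∈ s, a j • v j‖ ^ 2 ≤ C * ∑ j ∈ s, ‖a j‖ ^ 2) :
    ∃ T : lp (fun _ : ι => ℂ) 2 →L[ℂ] H, ∀ j, T (lp.single 2 j 1) = v j := by
  -- A nonpositive `C` may be replaced by `1`; positivity is needed to divide by `C` in the Cauchy
  -- criterion.
  wlog hC0 : 0 < C generalizing C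
  · refine this 1 (fun s a => (hC s a).trans ?_) one_pos
    gcongr
    linarith
  have hsum : ∀ a : lp (fun _ : ι => ℂ) 2, Summable fun j => a j • v j := fun a => by
    rw [summable_iff_vanishing_norm]
    intro ε hε
    obtain ⟨s, hs⟩ := summable_iff_vanishing_norm.1 (hasSum_norm_sq a).summable (ε ^ 2 / C)
      (by positivity)
    refine ⟨s, fun t ht => ?_⟩
    have h1 := hs t ht
    rw [Real.norm_of_nonneg (by positivity), lt_div_iff₀ hC0] at h1
    exact lt_of_pow_lt_pow_left₀ 2 hε.le ((hC t a).trans_lt (by linarith))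
  let T : lp (fun _ : ι => ℂ) 2 →ₗ[ℂ] H :=
    { toFun a := ∑' j, a j • v j
      map_add' a b := by
        rw [← (hsum a).tsum_add (hsum b)]
        simp [add_smul]
      map_smul' c a := by
        rw [RingHom.id_apply, ← (hsum a).tsum_const_smul]
        simp [mul_smul] }
  have hT : ∀ a, ‖T a‖ ≤ √C * ‖a‖ := fun a => by
    refine (abs_le_of_sq_le_sq' ?_ (by positivity)).2
    rw [mul_pow, Real.sq_sqrt hC0.le]
    refine le_of_tendsto_of_tendsto' ((hsum a).hasSum.norm.pow 2)
      ((hasSum_norm_sq a).mul_left C) fun s => ?_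
    rw [← Finset.mul_sum]
    exact hC s a
  refine ⟨T.mkContinuous _ hT, fun j => ?_⟩
  show ∑' i, (lp.single (E := fun _ : ι => ℂ) 2 j (1 : ℂ)) i • v i = v j
  rw [tsum_eq_single j]
  · simp
  · intro i hi
    simp [lp.single_apply, hi]

theorem lower_bound_synthesis (T : lp (fun _ : ι => ℂ) 2 →L[ℂ] H) (c : ℝ)
    (hc : ∀ (s : Finset ι) (a : ι → ℂ),
      c * ∑ j ∈ s, ‖a j‖ ^ 2 ≤ ‖∑ j ∈ s, a j • T (lp.single 2 j 1)‖ ^ 2)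
    (a : lp (fun _ : ι => ℂ) 2) : c * ‖a‖ ^ 2 ≤ ‖T a‖ ^ 2 :=
  le_of_tendsto_of_tendsto' ((hasSum_norm_sq a).mul_left c)
    (((hasSum_map_single T a).norm).pow 2) fun s => by
      rw [← Finset.mul_sum]
      exact hc s a

end Synthesis

/-! ### Schur's test and the factorisation of the interpolation operator -/

section Interpolation

/-- Schur's test for Gram matrices: absolutely bounded row sums give an upper Riesz bound. -/
theorem norm_sum_sq_le_of_gram {ι H : Type*} [NormedAddCommGroup H] [InnerProductSpace ℂ H]
    (v : ι → H) (M : ℝ) (hM : ∀ (k : ι) (s : Finset ι), ∑ j ∈ s, ‖inner ℂ (v k) (v j)‖ ≤ M)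
    (s : Finset ι) (a : ι → ℂ) : ‖∑ j ∈ s, a j • v j‖ ^ 2 ≤ M * ∑ j ∈ s, ‖a j‖ ^ 2 := by
  -- Here `‖a j‖ ‖a k‖` is bounded by the mean of the squares; the symmetry of the Gram moduli then
  -- merges the two halves.
  have h1 : ‖∑ j ∈ s, a j • v j‖ ^ 2 ≤
      ∑ j ∈ s, ∑ k ∈ s, (‖a j‖ ^ 2 + ‖a k‖ ^ 2) / 2 * ‖inner ℂ (v j) (v k)‖ := by
    have h0 : ‖∑ j ∈ s, a j • v j‖ ^ 2 = ‖inner ℂ (∑ j ∈ s, a j • v j) (∑ j ∈ s, a j • v j)‖ := by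
      simp [inner_self_eq_norm_sq_to_K]
    rw [h0, sum_inner]
    refine (norm_sum_le _ _).trans (Finset.sum_le_sum fun j _ => ?_)
    rw [inner_sum]
    refine (norm_sum_le _ _).trans (Finset.sum_le_sum fun k _ => ?_)
    rw [inner_smul_left, inner_smul_right, norm_mul, norm_mul, RCLike.norm_conj, ← mul_assoc]
    gcongr
    nlinarith [sq_nonneg (‖a j‖ - ‖a k‖)]
  have h2 : ∑ j ∈ s, ∑ k ∈ s, (‖a j‖ ^ 2 + ‖a k‖ ^ 2) / 2 * ‖inner ℂ (v j) (v k)‖ =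
      ∑ j ∈ s, ‖a j‖ ^ 2 * ∑ k ∈ s, ‖inner ℂ (v j) (v k)‖ := by
    have h3 : ∑ j ∈ s, ∑ k ∈ s, ‖a k‖ ^ 2 * ‖inner ℂ (v j) (v k)‖ =
        ∑ j ∈ s, ∑ k ∈ s, ‖a j‖ ^ 2 * ‖inner ℂ (v j) (v k)‖ := by
      rw [Finset.sum_comm]
      simp_rw [norm_inner_symm]
    simp_rw [add_div, add_mul, Finset.sum_add_distrib, div_mul_eq_mul_div, ← Finset.sum_div, h3,
      add_halves, Finset.mul_sum]
  rw [h2] at h1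
  refine h1.trans ?_
  rw [Finset.mul_sum]
  refine Finset.sum_le_sum fun j _ => ?_
  rw [mul_comm]
  gcongr
  exact hM j s

/-- A series converging in `Lᵖ` and pointwise almost everywhere has the same two sums. -/
theorem ae_hasSum_of_hasSum_Lp {ι α : Type*} [Countable ι] [MeasurableSpace α] {μ : Measure α}
    {f : ι → Lp ℂ 2 μ} {F : Lp ℂ 2 μ} (hf : HasSum f F)
    (hs : ∀ᵐ t ∂μ, Summable fun j => f j t) : ∀ᵐ t ∂μ, HasSum (fun j => f j t) (F t) := by
  -- `L²` convergence gives convergence in measure, hence a.e. convergence of a sequence of partial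
  -- sums; this pins down the pointwise sum.
  obtain ⟨ns, hns, hlim⟩ := (tendstoInMeasure_of_tendsto_Lp hf).exists_seq_tendsto_ae'
  have hsum : ∀ᵐ t ∂μ, ∀ s : Finset ι, (∑ j ∈ s, f j : Lp ℂ 2 μ) t = ∑ j ∈ s, f j t := by
    rw [ae_all_iff]
    intro s
    filter_upwards [Lp.coeFn_finsetSum s f] with t ht
    rw [ht, Finset.sum_apply]
  filter_upwards [hs, hlim, hsum] with t h1 h2 h3
  simp_rw [h3] at h2
  rw [tendsto_nhds_unique h2 (h1.hasSum.comp hns)]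
  exact h1.hasSum

variable {E : Type*} [NormedAddCommGroup E] [InnerProductSpace ℝ E] [FiniteDimensional ℝ E]
  [MeasurableSpace E] [BorelSpace E]

/-- The Gaussian interpolation operator factors as sampling, inversion of the interpolation matrix
and synthesis. -/
theorem isGaussianInterpolationOperator_comp {ι : Type*} [Countable ι] [DecidableEq ι] {K : Set E}
    {lam : ℝ} {w : ι → E}
    (A : lp (fun _ : ι => ℂ) 2 ≃L[ℂ] lp (fun _ : ι => ℂ) 2)
    (hA : ∀ j k, A (lp.single 2 j 1) k = gaussian lam (w k - w j))
    (P : paleyWiener K →L[ℂ] lp (fun _ : ι => ℂ) 2)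
    (hP : ∀ f k, P f k = pointValue f (w k))
    (S : lp (fun _ : ι => ℂ) 2 →L[ℂ] Lp (α := E) ℂ 2 volume)
    (hS : ∀ j, S (lp.single 2 j 1) =ᵐ[volume] fun t => gaussian lam (t - w j))
    (hsum : ∀ t, Summable fun j => ‖gaussian lam (t - w j)‖ ^ 2) :
    IsGaussianInterpolationOperator K lam w
      (S ∘L (A.symm : lp (fun _ : ι => ℂ) 2 →L[ℂ] lp (fun _ : ι => ℂ) 2) ∘L P) := by
  -- Coordinate evaluation is continuous on `ℓ²`, so the interpolation equations say exactly `A a =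
  -- P f`.
  have key : ∀ f a, Interpolates lam w f a ↔ a = A.symm (P f) := fun f a => by
    rw [ContinuousLinearEquiv.eq_symm_apply]
    have h : ∀ k, HasSum (fun j => a j * gaussian lam (w k - w j)) (A a k) := fun k => by
      have := hasSum_map_single (lp.evalCLM ℂ (fun _ : ι => ℂ) 2 k ∘L
        (A : lp (fun _ : ι => ℂ) 2 →L[ℂ] lp (fun _ : ι => ℂ) 2)) a
      simp_rw [← hA]
      exact this
    constructor
    · intro hI
      ext k
      rw [hP]
      exact (h k).unique (hI k)
    · intro hI k
      rw [← hP, ← hI]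
      exact h k
  intro f
  refine ⟨⟨A.symm (P f), (key f _).2 rfl, fun a ha => (key f a).1 ha⟩, fun a ha => ?_⟩
  obtain rfl := (key f a).1 ha
  set a := A.symm (P f)
  have hcoe : ∀ᵐ t : E, ∀ j, (a j • S (lp.single 2 j 1) : Lp (α := E) ℂ 2 volume) t =
      a j * gaussian lam (t - w j) := by
    rw [ae_all_iff]
    intro j
    filter_upwards [Lp.coeFn_smul (a j) (S (lp.single 2 j 1)), hS j] with t h1 h2
    rw [h1, Pi.smul_apply, h2, smul_eq_mul]
  have hpt : ∀ t, Summable fun j => a j * gaussian lam (t - w j) := fun t => by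
    refine Summable.of_norm_bounded ((hasSum_norm_sq a).summable.add (hsum t)) fun j => ?_
    rw [norm_mul]
    nlinarith [sq_nonneg (‖a j‖ - ‖gaussian lam (t - w j)‖), sq_nonneg (‖a j‖),
      sq_nonneg ‖gaussian lam (t - w j)‖]
  have h := ae_hasSum_of_hasSum_Lp (hasSum_map_single S a) (by
    filter_upwards [hcoe] with t ht
    simpa only [ht] using hpt t)
  filter_upwards [h, hcoe] with t h1 h2
  simp only [h2] at h1
  exact h1

/-- Both operators are a.e. the sum of the same series, for the one coefficient sequence solving the
problem. -/
theorem IsGaussianInterpolationOperator.unique {ι : Type*} {K : Set E} {lam : ℝ} {w : ι → E}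
    {T T' : paleyWiener K →L[ℂ] Lp (α := E) ℂ 2 volume}
    (hT : IsGaussianInterpolationOperator K lam w T)
    (hT' : IsGaussianInterpolationOperator K lam w T') : T = T' := by
  refine ContinuousLinearMap.ext fun f => Lp.ext ?_
  obtain ⟨a, ha, -⟩ := (hT f).1
  filter_upwards [(hT f).2 a ha, (hT' f).2 a ha] with t h1 h2
  exact h1.unique h2

/-- The operator is defined by choice with default `0`; a single witness rules out the default. -/
theorem IsGaussianInterpolationOperator.isGaussianInterpolationOperator {ι : Type*} {K : Set E}
    {lam : ℝ} {w : ι → E} {T : paleyWiener K →L[ℂ] Lp (α := E) ℂ 2 volume}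
    (hT : IsGaussianInterpolationOperator K lam w T) :
    IsGaussianInterpolationOperator K lam w (gaussianInterpolationOperator K lam w) := by
  have h : ∃ T, IsGaussianInterpolationOperator K lam w T := ⟨T, hT⟩
  rw [gaussianInterpolationOperator, dif_pos h]
  exact h.choose_spec

end Interpolation

/-! ### Riesz bounds, separation of the nodes, Gaussian row sums -/

section RieszBounds

/-- The norm inequalities are applied to finitely supported sequences. Finite sums are the form in
which norms can be written as integrals and compared. -/
theorem IsRieszBasis.finite_bounds {ι H : Type*} [NormedAddCommGroup H] [InnerProductSpace ℂ H]
    {φ : ι → H} (h : IsRieszBasis φ) :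
    ∃ c C : ℝ, 0 < c ∧ ∀ (s : Finset ι) (a : ι → ℂ),
      c * ∑ j ∈ s, ‖a j‖ ^ 2 ≤ ‖∑ j ∈ s, a j • φ j‖ ^ 2 ∧
        ‖∑ j ∈ s, a j • φ j‖ ^ 2 ≤ C * ∑ j ∈ s, ‖a j‖ ^ 2 := by
  classical
  obtain ⟨-, B, hB, hbd⟩ := h
  refine ⟨(B⁻¹) ^ 2, B ^ 2, by positivity, fun s a => ?_⟩
  let b : lp (fun _ : ι => ℂ) 2 := ∑ j ∈ s, lp.single 2 j (a j)
  have hb : ∀ j, b j = if j ∈ s then a j else 0 := fun j => by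
    simp only [b, lp.coeFn_sum, lp.coeFn_single]
    exact (Finset.sum_apply ..).trans (Finset.sum_pi_single j a s)
  have hnorm : ‖b‖ ^ 2 = ∑ j ∈ s, ‖a j‖ ^ 2 := by
    simpa using lp.norm_sum_single (p := 2) (by norm_num) a s
  have hsum : ∑' j, b j • φ j = ∑ j ∈ s, a j • φ j := by
    rw [tsum_eq_sum (s := s) fun j hj => by simp [hb, hj]]
    exact Finset.sum_congr rfl fun j hj => by simp [hb, hj]
  obtain ⟨-, h1, h2⟩ := hbd b
  rw [hsum] at h1 h2
  rw [← hnorm, ← mul_pow, ← mul_pow]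
  exact ⟨by gcongr, by gcongr⟩

/-- The squared norm of a finite linear combination in `L²` as an integral. -/
theorem norm_sq_sum_toLp {ι α : Type*} [MeasurableSpace α] {μ : Measure α} {g : ι → α → ℂ}
    (hg : ∀ j, MemLp (g j) 2 μ) (s : Finset ι) (a : ι → ℂ) :
    ‖∑ j ∈ s, a j • (hg j).toLp (g j)‖ ^ 2 = ∫ t, ‖∑ j ∈ s, a j * g j t‖ ^ 2 ∂μ := by
  have h1 : ∀ᵐ t ∂μ, (∑ j ∈ s, a j • (hg j).toLp (g j) : Lp ℂ 2 μ) t =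
      ∑ j ∈ s, a j * g j t := by
    have h2 : ∀ᵐ t ∂μ, ∀ j ∈ s, (a j • (hg j).toLp (g j) : Lp ℂ 2 μ) t = a j * g j t := by
      rw [Finset.eventually_all]
      intro j _
      filter_upwards [Lp.coeFn_smul (a j) ((hg j).toLp (g j)), (hg j).coeFn_toLp] with t h3 h4
      rw [h3, Pi.smul_apply, h4, smul_eq_mul]
    filter_upwards [Lp.coeFn_finsetSum s fun j => a j • (hg j).toLp (g j), h2] with t h5 h6
    rw [h5, Finset.sum_apply]
    exact Finset.sum_congr rfl h6
  rw [← @inner_self_eq_norm_sq ℂ, L2.inner_def]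
  have h7 : ∫ t, inner ℂ ((∑ j ∈ s, a j • (hg j).toLp (g j) : Lp ℂ 2 μ) t)
      ((∑ j ∈ s, a j • (hg j).toLp (g j) : Lp ℂ 2 μ) t) ∂μ =
      ∫ t, ((‖∑ j ∈ s, a j * g j t‖ ^ 2 : ℝ) : ℂ) ∂μ := by
    refine integral_congr_ae ?_
    filter_upwards [h1] with t ht
    rw [ht, inner_self_eq_norm_sq_to_K]
    simp
  rw [h7, integral_complex_ofReal]
  simp

/-- Exponentials of a Riesz-basis sequence have uniformly separated frequencies. -/
theorem IsRieszBasisSequence.separated {x : ℤ → ℝ} (hx : IsRieszBasisSequence x) :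
    ∃ δ : ℝ, 0 < δ ∧ ∀ j k : ℤ, δ * |((j - k : ℤ) : ℝ)| ≤ |x j - x k| := by
  obtain ⟨hlt, hR⟩ := hx
  obtain ⟨c, C, hc, hbd⟩ := hR.finite_bounds
  -- Coefficients `1, -1` on neighbouring exponentials: the lower bound gives `2 c`, while `|exp (i
  -- r) - 1| ≤ |r|` bounds the integral by `2π ((x (j + 1) - x j) π)²`.
  have hstep : ∀ j, c / Real.pi ^ 3 ≤ (x (j + 1) - x j) ^ 2 := fun j => by
    have hne : j ≠ j + 1 := by omega
    have h1 := (hbd {j, j + 1} fun i => if i = j then 1 else -1).1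
    have h2 := norm_sq_sum_toLp (fun i => memLp_expFun (x i)) {j, j + 1}
      fun i => if i = j then 1 else -1
    have h2' : ‖∑ i ∈ ({j, j + 1} : Finset ℤ), (if i = j then (1 : ℂ) else -1) • expFun (x i)‖ ^ 2
      = _ := h2
    rw [h2'] at h1
    have h3 : ∀ t ∈ Icc (-Real.pi) Real.pi, ‖∑ i ∈ ({j, j + 1} : Finset ℤ),
        (if i = j then (1 : ℂ) else -1) * Complex.exp (-(Complex.I * (x i * t : ℝ)))‖ ^ 2 ≤
        ((x (j + 1) - x j) * Real.pi) ^ 2 := fun t ht => by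
      have hfac : ∑ i ∈ ({j, j + 1} : Finset ℤ),
          (if i = j then (1 : ℂ) else -1) * Complex.exp (-(Complex.I * (x i * t : ℝ))) =
          -(Complex.exp (((-(x j * t) : ℝ) : ℂ) * Complex.I) *
            (Complex.exp (Complex.I * ((-((x (j + 1) - x j) * t) : ℝ) : ℂ)) - 1)) := by
        rw [Finset.sum_pair hne, mul_sub, ← Complex.exp_add]
        simp only [if_true, if_neg hne.symm]
        push_cast
        ring_nf
      rw [hfac, norm_neg, norm_mul, Complex.norm_exp_ofReal_mul_I, one_mul]
      have h4 := Real.norm_exp_I_mul_ofReal_sub_one_le (x := -((x (j + 1) - x j) * t))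
      have h5 : ‖-((x (j + 1) - x j) * t)‖ ≤ (x (j + 1) - x j) * Real.pi := by
        rw [norm_neg, norm_mul, Real.norm_of_nonneg (by linarith [hlt j])]
        have := hlt j
        gcongr
        exact abs_le.2 ht
      exact pow_le_pow_left₀ (norm_nonneg _) (h4.trans h5) 2
    have h6 := setIntegral_mono_on (μ := volume) (s := Icc (-Real.pi) Real.pi)
      (g := fun _ => ((x (j + 1) - x j) * Real.pi) ^ 2)
      (Continuous.integrableOn_Icc (by fun_prop)) (continuousOn_const.integrableOn_Icc)
      measurableSet_Icc h3
    have h7 := h1.trans h6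
    rw [Finset.sum_pair hne, setIntegral_const] at h7
    simp only [if_true, if_neg hne.symm, norm_one, norm_neg, smul_eq_mul, Measure.real,
      Real.volume_Icc] at h7
    rw [ENNReal.toReal_ofReal (by linarith [Real.pi_pos])] at h7
    rw [div_le_iff₀ (by positivity)]
    nlinarith
  set δ := √(c / Real.pi ^ 3)
  have hδ : 0 < δ := Real.sqrt_pos.2 (by positivity)
  have hstep' : ∀ j, δ ≤ x (j + 1) - x j := fun j =>
    (Real.sqrt_le_left (by linarith [hlt j])).2 (hstep j)
  have hnat : ∀ (j : ℤ) (n : ℕ), δ * n ≤ x (j + n) - x j := fun j n => by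
    induction n with
    | zero => simp
    | succ n ih =>
      have := hstep' (j + n)
      push_cast
      rw [← add_assoc]
      linarith
  have hle : ∀ j k : ℤ, k ≤ j → δ * |((j - k : ℤ) : ℝ)| ≤ |x j - x k| := fun j k hjk => by
    have h := hnat k (j - k).toNat
    have h8 : (((j - k).toNat : ℤ)) = j - k := Int.toNat_of_nonneg (by omega)
    have h9 : (((j - k).toNat : ℝ)) = ((j - k : ℤ) : ℝ) := by exact_mod_cast h8
    rw [h8, h9, add_sub_cancel] at h
    rw [abs_of_nonneg (by exact_mod_cast (by omega : 0 ≤ j - k))]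
    exact h.trans (le_abs_self _)
  refine ⟨δ, hδ, fun j k => ?_⟩
  rcases le_total k j with h | h
  · exact hle j k h
  · have := hle k j h
    rw [abs_sub_comm (x j), ← abs_neg ((j - k : ℤ) : ℝ)]
    simpa using this

theorem summable_exp_neg_mul_int_sq {c : ℝ} (hc : 0 < c) :
    Summable fun n : ℤ => Real.exp (-c * (n : ℝ) ^ 2) := by
  have h : Summable fun n : ℕ => Real.exp (-c * (n : ℝ) ^ 2) := by
    refine Summable.of_nonneg_of_le (fun _ => by positivity) (fun n => ?_)
      (Real.summable_exp_nat_mul_iff.2 (neg_lt_zero.2 hc))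
    rw [Real.exp_le_exp]
    have : (n : ℝ) ≤ (n : ℝ) ^ 2 := by exact_mod_cast Nat.le_self_pow two_ne_zero n
    nlinarith
  refine Summable.of_nat_of_neg ?_ ?_
  · simpa using h
  · simpa using h

/-- Gaussian row sums over a Riesz-basis sequence are uniformly bounded. -/
theorem IsRieszBasisSequence.sum_gaussian_le {x : ℤ → ℝ} (hx : IsRieszBasisSequence x) {μ : ℝ}
    (hμ : 0 < μ) : ∃ M : ℝ, ∀ (k : ℤ) (s : Finset ℤ),
      ∑ j ∈ s, Real.exp (-μ * (x k - x j) ^ 2) ≤ M := by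
  obtain ⟨δ, hδ, hsep⟩ := hx.separated
  have hs := summable_exp_neg_mul_int_sq (c := μ * δ ^ 2) (by positivity)
  -- Separation compares the row with a theta series in `n = k - j`, whose sum does not depend on
  -- `k`.
  refine ⟨∑' n : ℤ, Real.exp (-(μ * δ ^ 2) * (n : ℝ) ^ 2), fun k s => ?_⟩
  have hs' := (Equiv.subLeft k).summable_iff.2 hs
  rw [← (Equiv.subLeft k).tsum_eq]
  refine le_trans (Finset.sum_le_sum fun j _ => ?_) (hs'.sum_le_tsum s fun _ _ => by positivity)
  rw [Equiv.subLeft_apply, Real.exp_le_exp]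
  have h := pow_le_pow_left₀ (by positivity) (hsep k j) 2
  rw [sq_abs, mul_pow, sq_abs] at h
  nlinarith

/-- For `t` off the nodes, `(x 0 - x j)² ≤ 2 (t - x j)² + 2 (t - x 0)²` reduces to the row of `x 0`,
at the cost of halving `μ` and a constant factor. -/
theorem IsRieszBasisSequence.summable_gaussian {x : ℤ → ℝ} (hx : IsRieszBasisSequence x) {μ : ℝ}
    (hμ : 0 < μ) (t : ℝ) : Summable fun j => Real.exp (-μ * (t - x j) ^ 2) := by
  obtain ⟨M, hM⟩ := hx.sum_gaussian_le (μ := μ / 2) (by positivity)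
  have h : Summable fun j => Real.exp (-(μ / 2) * (x 0 - x j) ^ 2) :=
    summable_of_sum_le (fun _ => by positivity) (hM 0)
  refine Summable.of_nonneg_of_le (fun _ => by positivity) (fun j => ?_)
    (h.mul_left (Real.exp (μ * (t - x 0) ^ 2)))
  rw [← Real.exp_add, Real.exp_le_exp]
  nlinarith [sq_nonneg ((t - x j) - (x 0 - t)), mul_nonneg hμ.le (sq_nonneg ((t - x j) - (x 0 - t))),
    mul_nonneg hμ.le (sq_nonneg ((t - x j) + (x 0 - t)))]

end RieszBounds

/-! ### Point evaluation on the Fourier side -/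

section PointValue

variable {E : Type*} [NormedAddCommGroup E] [InnerProductSpace ℝ E]

/-- The set `(2π)⁻¹ K`: the frequency band `K` in the normalisation of Mathlib's `𝓕`. -/
def scaledBand (K : Set E) : Set E := {η | (2 * Real.pi) • η ∈ K}

theorem smul_mem_scaledBand {K : Set E} {ξ : E} : (2 * Real.pi)⁻¹ • ξ ∈ scaledBand K ↔ ξ ∈ K := by
  have h : (2 * Real.pi) ≠ 0 := by positivity
  simp only [scaledBand, mem_ofPred_eq, smul_inv_smul₀ h]

variable [MeasurableSpace E] [BorelSpace E]

theorem measurableSet_scaledBand {K : Set E} (hK : MeasurableSet K) :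
    MeasurableSet (scaledBand K) :=
  measurable_const_smul (2 * Real.pi) hK

variable [FiniteDimensional ℝ E]

theorem volume_scaledBand_ne_top {K : Set E} (hv : volume K ≠ ⊤) : volume (scaledBand K) ≠ ⊤ := by
  have : scaledBand K = (fun η => (2 * Real.pi) • η) ⁻¹' K := rfl
  rw [this, Measure.addHaar_preimage_smul _ (by positivity)]
  exact ENNReal.mul_ne_top ENNReal.ofReal_ne_top hv

/-- Dilation by `2π` and its inverse preserve null sets, so the band condition can be read off `𝓕`
directly. -/
theorem mem_paleyWiener_iff {K : Set E} {f : Lp (α := E) ℂ 2 volume} :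
    f ∈ paleyWiener K ↔ ∀ᵐ η : E, η ∉ scaledBand K → (𝓕 f : Lp (α := E) ℂ 2 volume) η = 0 := by
  have h2 : (2 * Real.pi) ≠ 0 := by positivity
  constructor
  · intro h
    have hq : Measure.QuasiMeasurePreserving (fun ξ : E => (2 * Real.pi) • ξ) volume volume := by
      refine ⟨measurable_const_smul _, ?_⟩
      rw [Measure.map_addHaar_smul volume h2]
      exact Measure.AbsolutelyContinuous.smul_left Measure.AbsolutelyContinuous.rfl _
    filter_upwards [hq.ae h] with η hη hK
    have := hη hK
    rwa [angularFourier, inv_smul_smul₀ h2] at this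
  · intro h
    show ∀ᵐ ξ : E, _
    filter_upwards [ae_smul_iff _ h] with ξ hξ hK
    exact hξ (by rwa [smul_mem_scaledBand])

/-- The function `η ↦ exp (-2πi ⟪η, t⟫)` restricted to `(2π)⁻¹ K`. -/
def windowFun (K : Set E) (t : E) : E → ℂ :=
  (scaledBand K).indicator fun η => Complex.exp (-(Complex.I * (2 * Real.pi * inner ℝ η t : ℝ)))

theorem memLp_windowFun {K : Set E} (hK : MeasurableSet K) (hv : volume K ≠ ⊤) (t : E) :
    MemLp (windowFun K t) 2 := by
  have : IsFiniteMeasure (volume.restrict (scaledBand K)) :=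
    isFiniteMeasure_restrict.2 (volume_scaledBand_ne_top hv)
  refine (memLp_indicator_iff_restrict (measurableSet_scaledBand hK)).2 ?_
  refine MemLp.of_bound (Continuous.aestronglyMeasurable (by fun_prop)) 1
    (Filter.Eventually.of_forall fun η => ?_)
  have h : -(Complex.I * ((2 * Real.pi * inner ℝ η t : ℝ) : ℂ)) =
      ((-(2 * Real.pi * inner ℝ η t) : ℝ) : ℂ) * Complex.I := by
    push_cast; ring
  rw [h, Complex.norm_exp_ofReal_mul_I]

/-- Point evaluation on the Paley-Wiener space is an inner product with a band-limited
exponential on the Fourier side. -/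
theorem pointValue_eq_inner {K : Set E} (hK : MeasurableSet K) (hv : volume K ≠ ⊤)
    (f : paleyWiener K) (t : E) :
    pointValue f t = inner ℂ ((memLp_windowFun hK hv t).toLp _)
      (𝓕 (f : Lp (α := E) ℂ 2 volume) : Lp (α := E) ℂ 2 volume) := by
  have h2 : (2 * Real.pi) ≠ 0 := by positivity
  have h1 : inner ℂ ((memLp_windowFun hK hv t).toLp _)
      (𝓕 (f : Lp (α := E) ℂ 2 volume) : Lp (α := E) ℂ 2 volume) =
      ∫ η, (𝓕 (f : Lp (α := E) ℂ 2 volume) : Lp (α := E) ℂ 2 volume) η *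
        (starRingEnd ℂ) (windowFun K t η) := by
    rw [L2.inner_def]
    refine integral_congr_ae ?_
    filter_upwards [(memLp_windowFun hK hv t).coeFn_toLp] with η hη
    rw [hη, RCLike.inner_apply]
  -- Substitution `ξ = 2π η`: the Jacobian `(2π)^d` cancels the normalisation of `pointValue`.
  have h3 := Measure.integral_comp_smul_of_nonneg (volume : Measure E)
    (fun η => (𝓕 (f : Lp (α := E) ℂ 2 volume) : Lp (α := E) ℂ 2 volume) η *
        (starRingEnd ℂ) (windowFun K t η)) (2 * Real.pi)⁻¹ (hR := by positivity)
  rw [h1, pointValue, ← integral_indicator hK]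
  have h4 : K.indicator (fun ξ => angularFourier (f : Lp (α := E) ℂ 2 volume) ξ *
      Complex.exp (Complex.I * (inner ℝ ξ t : ℝ))) = fun ξ =>
      (𝓕 (f : Lp (α := E) ℂ 2 volume) : Lp (α := E) ℂ 2 volume) ((2 * Real.pi)⁻¹ • ξ) *
        (starRingEnd ℂ) (windowFun K t ((2 * Real.pi)⁻¹ • ξ)) := by
    ext ξ
    by_cases hξ : ξ ∈ K
    · rw [indicator_of_mem hξ, windowFun, indicator_of_mem (smul_mem_scaledBand.2 hξ),
        angularFourier, ← Complex.exp_conj, real_inner_smul_left, mul_inv_cancel_left₀ h2]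
      simp
    · rw [indicator_of_notMem hξ, windowFun,
        indicator_of_notMem (fun h => hξ (smul_mem_scaledBand.1 h))]
      simp
  rw [h4, h3, inv_pow, inv_inv, smul_smul, inv_mul_cancel₀ (by positivity), one_smul]

theorem measurableSet_band : MeasurableSet band := measurableSet_Icc

theorem volume_band_ne_top : volume band ≠ ⊤ := by
  rw [band, Real.volume_Icc]
  exact ENNReal.ofReal_ne_top

end PointValue

/-! ### The three factors on the line -/

section OneDimensional

theorem gaussian_real (lam t : ℝ) : gaussian lam t = ((Real.exp (-lam * t ^ 2) : ℝ) : ℂ) := by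
  rw [gaussian, Real.norm_eq_abs, sq_abs]

theorem norm_gaussian_real (lam t : ℝ) : ‖gaussian lam t‖ = Real.exp (-lam * t ^ 2) := by
  rw [gaussian_real, Complex.norm_real, Real.norm_of_nonneg (by positivity)]

theorem norm_sq_gaussian_real (lam t : ℝ) :
    ‖gaussian lam t‖ ^ 2 = Real.exp (-(2 * lam) * t ^ 2) := by
  rw [norm_gaussian_real, ← Real.exp_nat_mul]
  congr 1
  push_cast
  ring

theorem memLp_gaussian_sub {lam : ℝ} (hlam : 0 < lam) (s : ℝ) :
    MemLp (fun t : ℝ => gaussian lam (t - s)) 2 := by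
  have hm : AEStronglyMeasurable (fun t : ℝ => gaussian lam (t - s)) volume := by
    simp_rw [gaussian_real]
    exact Continuous.aestronglyMeasurable (by fun_prop)
  rw [memLp_two_iff_integrable_sq_norm hm]
  simp_rw [norm_sq_gaussian_real]
  exact (integrable_exp_neg_mul_sq (b := 2 * lam) (by positivity)).comp_sub_right s

/-- Completing the square: `(t - s)² + (t - r)² = 2 (t - (s + r) / 2)² + (s - r)² / 2`. -/
theorem inner_gaussian_sub {lam : ℝ} (hlam : 0 < lam) (s r : ℝ) :
    inner ℂ ((memLp_gaussian_sub hlam s).toLp _) ((memLp_gaussian_sub hlam r).toLp _) =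
      ((√(Real.pi / (2 * lam)) * Real.exp (-(lam / 2) * (s - r) ^ 2) : ℝ) : ℂ) := by
  rw [L2.inner_def]
  have h : ∫ t, inner ℂ ((memLp_gaussian_sub hlam s).toLp _ t)
      ((memLp_gaussian_sub hlam r).toLp _ t) =
      ∫ t : ℝ, ((Real.exp (-(2 * lam) * (t - (s + r) / 2) ^ 2) *
        Real.exp (-(lam / 2) * (s - r) ^ 2) : ℝ) : ℂ) := by
    refine integral_congr_ae ?_
    filter_upwards [(memLp_gaussian_sub hlam s).coeFn_toLp,
      (memLp_gaussian_sub hlam r).coeFn_toLp] with t h1 h2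
    rw [h1, h2, RCLike.inner_apply, gaussian_real, gaussian_real, Complex.conj_ofReal,
      ← Complex.ofReal_mul, ← Real.exp_add, ← Real.exp_add]
    congr 2
    ring
  rw [h, integral_complex_ofReal, integral_mul_const,
    integral_sub_right_eq_self (fun t => Real.exp (-(2 * lam) * t ^ 2)), integral_gaussian]

/-- The Gram matrix of the translates is again Gaussian, with `lam / 2` for `lam`, so Schur's test
applies. -/
theorem IsRieszBasisSequence.exists_gaussian_synthesis {x : ℤ → ℝ} (hx : IsRieszBasisSequence x)
    {lam : ℝ} (hlam : 0 < lam) :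
    ∃ S : lp (fun _ : ℤ => ℂ) 2 →L[ℂ] Lp (α := ℝ) ℂ 2 volume,
      ∀ j, S (lp.single 2 j 1) =ᵐ[volume] fun t => gaussian lam (t - x j) := by
  obtain ⟨M, hM⟩ := hx.sum_gaussian_le (μ := lam / 2) (by positivity)
  obtain ⟨S, hS⟩ := exists_synthesis (fun j => (memLp_gaussian_sub hlam (x j)).toLp _) _
    (norm_sum_sq_le_of_gram _ (√(Real.pi / (2 * lam)) * M) fun k s => by
      simp_rw [inner_gaussian_sub hlam, Complex.norm_real]
      have h : ∀ j, ‖√(Real.pi / (2 * lam)) * Real.exp (-(lam / 2) * (x k - x j) ^ 2)‖ =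
          √(Real.pi / (2 * lam)) * Real.exp (-(lam / 2) * (x k - x j) ^ 2) := fun j =>
        Real.norm_of_nonneg (by positivity)
      simp_rw [h, ← Finset.mul_sum]
      gcongr
      exact hM k s)
  refine ⟨S, fun j => ?_⟩
  rw [hS]
  exact (memLp_gaussian_sub hlam (x j)).coeFn_toLp

/-- A Gaussian times an exponential; its translates in frequency have the Gaussian interpolation
matrix as Gram matrix, up to a constant. -/
def modulatedGaussian (lam s ξ : ℝ) : ℂ :=
  (Real.exp (-(8 * lam)⁻¹ * ξ ^ 2) : ℝ) * Complex.exp (-(Complex.I * (s * ξ : ℝ)))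

theorem norm_exp_neg_I_mul (r : ℝ) : ‖Complex.exp (-(Complex.I * (r : ℂ)))‖ = 1 := by
  have h : -(Complex.I * (r : ℂ)) = ((-r : ℝ) : ℂ) * Complex.I := by push_cast; ring
  rw [h, Complex.norm_exp_ofReal_mul_I]

theorem memLp_modulatedGaussian {lam : ℝ} (hlam : 0 < lam) (s : ℝ) :
    MemLp (modulatedGaussian lam s) 2 := by
  have hm : AEStronglyMeasurable (modulatedGaussian lam s) volume := by
    unfold modulatedGaussian
    exact Continuous.aestronglyMeasurable (by fun_prop)
  rw [memLp_two_iff_integrable_sq_norm hm]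
  refine (integrable_exp_neg_mul_sq (b := (4 * lam)⁻¹) (by positivity)).congr
    (Filter.Eventually.of_forall fun ξ => ?_)
  simp only [modulatedGaussian]
  rw [norm_mul, norm_exp_neg_I_mul, mul_one, Complex.norm_real,
    Real.norm_of_nonneg (by positivity), ← Real.exp_nat_mul]
  congr 1
  field_simp
  ring

/-- The two damping factors multiply to `exp (-ξ² / (4 lam))`, whose Fourier transform is a multiple
of the Gaussian with parameter `lam`; this dictates the constant `8 lam`. -/
theorem inner_modulatedGaussian {lam : ℝ} (hlam : 0 < lam) (s r : ℝ) :
    inner ℂ ((memLp_modulatedGaussian hlam s).toLp _) ((memLp_modulatedGaussian hlam r).toLp _) =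
      (√(4 * Real.pi * lam) : ℝ) * gaussian lam (s - r) := by
  rw [L2.inner_def]
  have h : ∫ t, inner ℂ ((memLp_modulatedGaussian hlam s).toLp _ t)
      ((memLp_modulatedGaussian hlam r).toLp _ t) =
      ∫ ξ : ℝ, Complex.exp (Complex.I * ((s - r : ℝ) : ℂ) * ξ) *
        Complex.exp (-(((4 * lam)⁻¹ : ℝ) : ℂ) * ξ ^ 2) := by
    refine integral_congr_ae ?_
    filter_upwards [(memLp_modulatedGaussian hlam s).coeFn_toLp,
      (memLp_modulatedGaussian hlam r).coeFn_toLp] with t h1 h2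
    rw [h1, h2, RCLike.inner_apply, modulatedGaussian, modulatedGaussian, map_mul,
      Complex.conj_ofReal, ← Complex.exp_conj, Complex.ofReal_exp, ← Complex.exp_add,
      ← Complex.exp_add, ← Complex.exp_add, ← Complex.exp_add]
    congr 1
    have hl : (lam : ℂ) ≠ 0 := by exact_mod_cast hlam.ne'
    simp only [map_neg, map_mul, Complex.conj_I, Complex.conj_ofReal]
    push_cast
    field_simp
    ring
  rw [h, fourierIntegral_gaussian (by rw [Complex.ofReal_re]; positivity), gaussian_real]
  congr 1
  · rw [← Complex.ofReal_div, show (1 / 2 : ℂ) = ((1 / 2 : ℝ) : ℂ) by push_cast; rfl,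
      ← Complex.ofReal_cpow (by positivity), ← Real.sqrt_eq_rpow]
    congr 2
    field_simp
  · rw [Complex.ofReal_exp]
    congr 1
    have hl : (lam : ℂ) ≠ 0 := by exact_mod_cast hlam.ne'
    push_cast
    field_simp

/-- The interpolation matrix of a Riesz-basis sequence is boundedly invertible on `ℓ²`. -/
theorem IsRieszBasisSequence.exists_interpolation_matrix {x : ℤ → ℝ} (hx : IsRieszBasisSequence x)
    {lam : ℝ} (hlam : 0 < lam) :
    ∃ A : lp (fun _ : ℤ => ℂ) 2 ≃L[ℂ] lp (fun _ : ℤ => ℂ) 2,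
      ∀ j k, A (lp.single 2 j 1) k = gaussian lam (x k - x j) := by
  set C := √(4 * Real.pi * lam)
  have hC : 0 < C := Real.sqrt_pos.2 (by positivity)
  have hC' : (C : ℂ) ≠ 0 := by exact_mod_cast hC.ne'
  obtain ⟨M, hM⟩ := hx.sum_gaussian_le hlam
  obtain ⟨c, _, hc, hR⟩ := hx.2.finite_bounds
  obtain ⟨T, hT⟩ := exists_synthesis (fun j => (memLp_modulatedGaussian hlam (x j)).toLp _) _
    (norm_sum_sq_le_of_gram _ (C * M) fun k s => by
      simp_rw [inner_modulatedGaussian hlam, norm_mul, norm_gaussian_real, Complex.norm_real,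
        ← Finset.mul_sum]
      rw [Real.norm_of_nonneg hC.le]
      gcongr
      exact hM k s)
  -- The minimum on `[-π, π]` of the squared damping factor `exp (-ξ² / (4 lam))`. The lower bound
  -- for `T` discards the integral outside this interval.
  set q := Real.exp (-(4 * lam)⁻¹ * Real.pi ^ 2)
  have hlow := lower_bound_synthesis T (q * c) fun s a => by
    simp_rw [hT]
    rw [norm_sq_sum_toLp]
    have h1 := (hR s a).1
    have h2 : ‖∑ j ∈ s, a j • expFun (x j)‖ ^ 2 = _ :=
      norm_sq_sum_toLp (fun j => memLp_expFun (x j)) s a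
    rw [h2] at h1
    rw [mul_assoc]
    have hint : Integrable fun ξ => ‖∑ j ∈ s, a j * modulatedGaussian lam (x j) ξ‖ ^ 2 := by
      have : MemLp (fun ξ => ∑ j ∈ s, a j * modulatedGaussian lam (x j) ξ) 2 :=
        memLp_finsetSum s fun j _ => (memLp_modulatedGaussian hlam (x j)).const_mul (a j)
      exact (memLp_two_iff_integrable_sq_norm this.1).1 this
    calc q * (c * ∑ j ∈ s, ‖a j‖ ^ 2)
        ≤ q * ∫ t in Icc (-Real.pi) Real.pi,
            ‖∑ j ∈ s, a j * Complex.exp (-(Complex.I * (x j * t : ℝ)))‖ ^ 2 := by gcongr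
      _ = ∫ t in Icc (-Real.pi) Real.pi,
            q * ‖∑ j ∈ s, a j * Complex.exp (-(Complex.I * (x j * t : ℝ)))‖ ^ 2 :=
          (integral_const_mul _ _).symm
      _ ≤ ∫ t in Icc (-Real.pi) Real.pi,
            ‖∑ j ∈ s, a j * modulatedGaussian lam (x j) t‖ ^ 2 := by
          refine setIntegral_mono_on (Continuous.integrableOn_Icc (by fun_prop))
            hint.integrableOn measurableSet_Icc fun t ht => ?_
          have h3 : ∑ j ∈ s, a j * modulatedGaussian lam (x j) t =
              (Real.exp (-(8 * lam)⁻¹ * t ^ 2) : ℝ) *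
                ∑ j ∈ s, a j * Complex.exp (-(Complex.I * (x j * t : ℝ))) := by
            rw [Finset.mul_sum]
            refine Finset.sum_congr rfl fun j _ => ?_
            rw [modulatedGaussian]
            ring
          rw [h3, norm_mul, mul_pow, Complex.norm_real, Real.norm_of_nonneg (by positivity),
            ← Real.exp_nat_mul]
          gcongr
          have h4 : t ^ 2 ≤ Real.pi ^ 2 := sq_le_sq' ht.1 ht.2
          have h5 : ((2 : ℕ) : ℝ) * (-(8 * lam)⁻¹ * t ^ 2) = -(4 * lam)⁻¹ * t ^ 2 := by
            field_simp
            ring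
          rw [h5, Real.exp_le_exp, neg_mul, neg_mul, neg_le_neg_iff]
          gcongr
      _ ≤ _ := setIntegral_le_integral hint (Filter.Eventually.of_forall fun _ => by positivity)
  -- `T* T` is coercive, since its quadratic form at `a` is `‖T a‖² ≥ q c ‖a‖²`.
  have hunit : IsUnit (ContinuousLinearMap.adjoint T ∘L T) := by
    refine ContinuousLinearMap.isUnit_of_forall_le_norm_inner_map _
      (c := ⟨q * c, by positivity⟩) (show 0 < q * c by positivity) fun a => ?_
    rw [ContinuousLinearMap.comp_apply, ContinuousLinearMap.adjoint_inner_left,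
      inner_self_eq_norm_sq_to_K]
    have := hlow a
    rw [norm_pow, RCLike.norm_ofReal, abs_norm, mul_comm]
    exact this
  obtain ⟨u, hu⟩ := hunit
  set A₀ := ContinuousLinearEquiv.ofUnit u
  have hA₀ : (A₀ : lp (fun _ : ℤ => ℂ) 2 →L[ℂ] lp (fun _ : ℤ => ℂ) 2) =
      ContinuousLinearMap.adjoint T ∘L T := hu
  refine ⟨A₀.trans (ContinuousLinearEquiv.smulLeft (Units.mk0 (C : ℂ)⁻¹ (inv_ne_zero hC'))),
    fun j k => ?_⟩
  have hval : A₀ (lp.single 2 j 1) = ContinuousLinearMap.adjoint T (T (lp.single 2 j 1)) := by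
    rw [← ContinuousLinearEquiv.coe_coe, hA₀]
    rfl
  have h6 : A₀ (lp.single 2 j 1) k = C * gaussian lam (x k - x j) := by
    rw [← inner_modulatedGaussian hlam, ← hT, ← hT, ← ContinuousLinearMap.adjoint_inner_right,
      ← hval, lp.inner_single_left]
    simp
  show (C : ℂ)⁻¹ * A₀ (lp.single 2 j 1) k = _
  rw [h6, inv_mul_cancel_left₀ hC']

/-- Point values are inner products with window functions, so sampling is the adjoint of their
synthesis after `𝓕`. Dilation by `2π` turns the windows into the given exponentials, and the upper
Riesz bound acquires the Jacobian `(2π)⁻¹`. -/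
theorem IsRieszBasisSequence.exists_sampling {x : ℤ → ℝ} (hx : IsRieszBasisSequence x) :
    ∃ P : paleyWiener band →L[ℂ] lp (fun _ : ℤ => ℂ) 2, ∀ f k, P f k = pointValue f (x k) := by
  obtain ⟨_, C, -, hR⟩ := hx.2.finite_bounds
  have h2 : (0 : ℝ) ≤ 2 * Real.pi := by positivity
  obtain ⟨U, hU⟩ := exists_synthesis
    (fun j => (memLp_windowFun measurableSet_band volume_band_ne_top (x j)).toLp _)
    ((2 * Real.pi)⁻¹ * C) fun s a => by
      rw [norm_sq_sum_toLp, mul_assoc]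
      refine le_trans (le_of_eq ?_) (mul_le_mul_of_nonneg_left (hR s a).2 (by positivity))
      have h3 : ‖∑ j ∈ s, a j • expFun (x j)‖ ^ 2 = _ :=
        norm_sq_sum_toLp (fun j => memLp_expFun (x j)) s a
      have h4 := Measure.integral_comp_smul_of_nonneg (volume : Measure ℝ)
        (fun t => (Icc (-Real.pi) Real.pi).indicator
          (fun t => ‖∑ j ∈ s, a j * Complex.exp (-(Complex.I * (x j * t : ℝ)))‖ ^ 2) t)
        (2 * Real.pi) (hR := h2)
      rw [Module.finrank_self, pow_one, integral_indicator measurableSet_Icc, smul_eq_mul] at h4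
      rw [h3, ← h4]
      refine integral_congr_ae (Filter.Eventually.of_forall fun η => ?_)
      by_cases hη : (2 * Real.pi) • η ∈ band
      · simp only [windowFun]
        rw [indicator_of_mem (show _ ∈ Icc _ _ from hη)]
        simp only [indicator_of_mem (show η ∈ scaledBand band from hη)]
        congr 3 with j
        congr 4
        simp only [RCLike.inner_apply, conj_trivial, smul_eq_mul]
        ring_nf
      · simp only [windowFun]
        rw [indicator_of_notMem (show _ ∉ Icc _ _ from hη)]
        simp only [indicator_of_notMem (show η ∉ scaledBand band from hη)]
        simp
  refine ⟨ContinuousLinearMap.adjoint U ∘L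
    ((Lp.fourierTransformₗᵢ ℝ ℂ).toContinuousLinearEquiv : _ →L[ℂ] _) ∘L (paleyWiener band).subtypeL,
    fun f k => ?_⟩
  rw [pointValue_eq_inner measurableSet_band volume_band_ne_top, ← hU,
    ← ContinuousLinearMap.adjoint_inner_right, lp.inner_single_left]
  simp
  rfl

end OneDimensional

/-! ### Product functions in `L²(ℝ²)` -/

section PlaneTensor

/-- The plane as a product, as a measurable equivalence. -/
def planeEquiv : EuclideanSpace ℝ (Fin 2) ≃ᵐ ℝ × ℝ :=
  (MeasurableEquiv.toLp 2 (Fin 2 → ℝ)).symm.trans MeasurableEquiv.finTwoArrow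

theorem planeEquiv_apply (z : EuclideanSpace ℝ (Fin 2)) : planeEquiv z = (z 0, z 1) := rfl

theorem measurePreserving_planeEquiv : MeasurePreserving planeEquiv volume volume :=
  (volume_preserving_finTwoArrow ℝ).comp
    (EuclideanSpace.volume_preserving_symm_measurableEquiv_toLp (Fin 2))

theorem quasiMeasurePreserving_coord_zero :
    Measure.QuasiMeasurePreserving (fun z : EuclideanSpace ℝ (Fin 2) => z 0) volume volume :=
  Measure.quasiMeasurePreserving_fst.comp measurePreserving_planeEquiv.quasiMeasurePreserving

theorem quasiMeasurePreserving_coord_one :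
    Measure.QuasiMeasurePreserving (fun z : EuclideanSpace ℝ (Fin 2) => z 1) volume volume :=
  Measure.quasiMeasurePreserving_snd.comp measurePreserving_planeEquiv.quasiMeasurePreserving

theorem integrable_coord_mul {f h : ℝ → ℂ} (hf : Integrable f) (hh : Integrable h) :
    Integrable fun z : EuclideanSpace ℝ (Fin 2) => f (z 0) * h (z 1) :=
  measurePreserving_planeEquiv.integrable_comp_of_integrable
    (g := fun p : ℝ × ℝ => f p.1 * h p.2) (hf.mul_prod hh)

theorem integral_coord_mul (f h : ℝ → ℂ) :
    ∫ z : EuclideanSpace ℝ (Fin 2), f (z 0) * h (z 1) = (∫ s, f s) * ∫ t, h t := by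
  rw [← integral_prod_mul]
  exact measurePreserving_planeEquiv.integral_comp' (fun p : ℝ × ℝ => f p.1 * h p.2)

theorem MemLp.coord_mul {f h : ℝ → ℂ} (hf : MemLp f 2) (hh : MemLp h 2) :
    MemLp (fun z : EuclideanSpace ℝ (Fin 2) => f (z 0) * h (z 1)) 2 := by
  have hm : AEStronglyMeasurable (fun z : EuclideanSpace ℝ (Fin 2) => f (z 0) * h (z 1)) volume :=
    (hf.1.comp_quasiMeasurePreserving quasiMeasurePreserving_coord_zero).mul
      (hh.1.comp_quasiMeasurePreserving quasiMeasurePreserving_coord_one)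
  rw [memLp_two_iff_integrable_sq_norm hm]
  have h1 := (memLp_two_iff_integrable_sq_norm hf.1).1 hf
  have h2 := (memLp_two_iff_integrable_sq_norm hh.1).1 hh
  have h3 := measurePreserving_planeEquiv.integrable_comp_of_integrable
    (g := fun p : ℝ × ℝ => ‖f p.1‖ ^ 2 * ‖h p.2‖ ^ 2) (h1.mul_prod h2)
  refine h3.congr (Filter.Eventually.of_forall fun z => ?_)
  simp only [Function.comp_apply, planeEquiv_apply, norm_mul, mul_pow]

/-- The function `(s, t) ↦ f s * h t` as an element of `L²(ℝ²)`. -/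
def planeTensorFun (f h : Lp (α := ℝ) ℂ 2 volume) :
    Lp (α := EuclideanSpace ℝ (Fin 2)) ℂ 2 volume :=
  (MemLp.coord_mul (Lp.memLp f) (Lp.memLp h)).toLp _

theorem coeFn_planeTensorFun (f h : Lp (α := ℝ) ℂ 2 volume) :
    ∀ᵐ z, planeTensorFun f h z = f (z 0) * h (z 1) :=
  (MemLp.coord_mul (Lp.memLp f) (Lp.memLp h)).coeFn_toLp

theorem inner_planeTensorFun (f h f' h' : Lp (α := ℝ) ℂ 2 volume) :
    inner ℂ (planeTensorFun f h) (planeTensorFun f' h') = inner ℂ f f' * inner ℂ h h' := by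
  rw [L2.inner_def, L2.inner_def, L2.inner_def, ← integral_coord_mul]
  refine integral_congr_ae ?_
  filter_upwards [coeFn_planeTensorFun f h, coeFn_planeTensorFun f' h'] with z h1 h2
  simp only [h1, h2, RCLike.inner_apply, map_mul]
  ring

theorem norm_planeTensorFun (f h : Lp (α := ℝ) ℂ 2 volume) :
    ‖planeTensorFun f h‖ = ‖f‖ * ‖h‖ := by
  have h1 := inner_planeTensorFun f h f h
  simp only [inner_self_eq_norm_sq_to_K] at h1
  have h2 : ‖planeTensorFun f h‖ ^ 2 = (‖f‖ * ‖h‖) ^ 2 := by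
    rw [mul_pow]
    exact_mod_cast h1
  exact (pow_left_inj₀ (norm_nonneg _) (by positivity) two_ne_zero).1 h2

/-- The bilinear map sending `f, h ∈ L²(ℝ)` to `(s, t) ↦ f s * h t` in `L²(ℝ²)`. -/
def planeTensor : Lp (α := ℝ) ℂ 2 volume →L[ℂ] Lp (α := ℝ) ℂ 2 volume →L[ℂ]
    Lp (α := EuclideanSpace ℝ (Fin 2)) ℂ 2 volume :=
  LinearMap.mkContinuous₂
    (LinearMap.mk₂ ℂ planeTensorFun
      (fun f f' h => by
        refine Lp.ext ?_
        filter_upwards [coeFn_planeTensorFun (f + f') h, coeFn_planeTensorFun f h,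
          coeFn_planeTensorFun f' h, Lp.coeFn_add (planeTensorFun f h) (planeTensorFun f' h),
          quasiMeasurePreserving_coord_zero.ae (Lp.coeFn_add f f')] with z h1 h2 h3 h4 h5
        rw [h1, h4, Pi.add_apply, h2, h3, h5, Pi.add_apply, add_mul])
      (fun c f h => by
        refine Lp.ext ?_
        filter_upwards [coeFn_planeTensorFun (c • f) h, coeFn_planeTensorFun f h,
          Lp.coeFn_smul c (planeTensorFun f h),
          quasiMeasurePreserving_coord_zero.ae (Lp.coeFn_smul c f)] with z h1 h2 h4 h5
        rw [h1, h4, Pi.smul_apply, h2, h5, Pi.smul_apply, smul_mul_assoc])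
      (fun f h h' => by
        refine Lp.ext ?_
        filter_upwards [coeFn_planeTensorFun f (h + h'), coeFn_planeTensorFun f h,
          coeFn_planeTensorFun f h', Lp.coeFn_add (planeTensorFun f h) (planeTensorFun f h'),
          quasiMeasurePreserving_coord_one.ae (Lp.coeFn_add h h')] with z h1 h2 h3 h4 h5
        rw [h1, h4, Pi.add_apply, h2, h3, h5, Pi.add_apply, mul_add])
      (fun c f h => by
        refine Lp.ext ?_
        filter_upwards [coeFn_planeTensorFun f (c • h), coeFn_planeTensorFun f h,
          Lp.coeFn_smul c (planeTensorFun f h),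
          quasiMeasurePreserving_coord_one.ae (Lp.coeFn_smul c h)] with z h1 h2 h4 h5
        rw [h1, h4, Pi.smul_apply, h2, h5, Pi.smul_apply, mul_smul_comm]))
    1 fun f h => by rw [one_mul, LinearMap.mk₂_apply, norm_planeTensorFun]

theorem coeFn_planeTensor (f h : Lp (α := ℝ) ℂ 2 volume) :
    ∀ᵐ z, planeTensor f h z = f (z 0) * h (z 1) :=
  coeFn_planeTensorFun f h

theorem inner_planeTensor (f h f' h' : Lp (α := ℝ) ℂ 2 volume) :
    inner ℂ (planeTensor f h) (planeTensor f' h') = inner ℂ f f' * inner ℂ h h' :=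
  inner_planeTensorFun f h f' h'

/-- Product functions are total in `L²(ℝ²)`. -/
theorem eq_zero_of_inner_planeTensor (v : Lp (α := EuclideanSpace ℝ (Fin 2)) ℂ 2 volume)
    (hv : ∀ f h, inner ℂ (planeTensor f h) v = 0) : v = 0 := by
  let G : ℝ × ℝ → ℂ := fun p => v (planeEquiv.symm p)
  have hGv : ∀ z, G (planeEquiv z) = v z := fun z => by simp [G]
  have hGm : StronglyMeasurable G :=
    (Lp.stronglyMeasurable v).comp_measurable planeEquiv.symm.measurable
  have hG : MemLp G 2 (volume.prod volume) :=
    (Lp.memLp v).comp_measurePreserving measurePreserving_planeEquiv.symm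
  have hint : ∀ f h : Lp (α := ℝ) ℂ 2 volume, Integrable
      (fun p : ℝ × ℝ => G p * (starRingEnd ℂ) (f p.1 * h p.2)) (volume.prod volume) ∧
      ∫ p : ℝ × ℝ, G p * (starRingEnd ℂ) (f p.1 * h p.2) ∂(volume.prod volume) = 0 := fun f h => by
    have h1 : (fun z => inner ℂ (planeTensor f h z) (v z)) =ᵐ[volume]
        (fun p : ℝ × ℝ => G p * (starRingEnd ℂ) (f p.1 * h p.2)) ∘ planeEquiv := by
      filter_upwards [coeFn_planeTensor f h] with z hz
      rw [hz, RCLike.inner_apply, Function.comp_apply, hGv, planeEquiv_apply]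
    constructor
    · exact (measurePreserving_planeEquiv.integrable_comp_emb
        planeEquiv.measurableEmbedding).1 ((L2.integrable_inner (𝕜 := ℂ) _ v).congr h1)
    · rw [← hv f h, L2.inner_def, integral_congr_ae h1]
      exact (measurePreserving_planeEquiv.integral_comp' _).symm
  -- Indicators of finite-measure sets as first factors force the slice integral against `h` to
  -- vanish for a.e. `s`.
  have hslice : ∀ h : Lp (α := ℝ) ℂ 2 volume, ∀ᵐ s : ℝ, ∫ t, G (s, t) * (starRingEnd ℂ) (h t) = 0 :=
    fun h => by
      have key : ∀ A : Set ℝ, MeasurableSet A → volume A < ⊤ →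
          IntegrableOn (fun s => ∫ t, G (s, t) * (starRingEnd ℂ) (h t)) A ∧
          ∫ s in A, ∫ t, G (s, t) * (starRingEnd ℂ) (h t) = 0 := fun A hA hA' => by
        obtain ⟨i1, i2⟩ := hint (indicatorConstLp 2 hA hA'.ne 1) h
        have h2 : (fun s => ∫ t, G (s, t) * (starRingEnd ℂ)
            ((indicatorConstLp 2 hA hA'.ne (1 : ℂ) : Lp (α := ℝ) ℂ 2 volume) s * h t)) =ᵐ[volume]
            A.indicator fun s => ∫ t, G (s, t) * (starRingEnd ℂ) (h t) := by
          filter_upwards [indicatorConstLp_coeFn (p := 2) (hs := hA) (hμs := hA'.ne)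
            (c := (1 : ℂ))] with s hs
          rw [hs]
          by_cases hsA : s ∈ A <;> simp [hsA]
        constructor
        · exact (integrable_indicator_iff hA).1 (i1.integral_prod_left.congr h2)
        · rw [← integral_indicator hA, ← integral_congr_ae h2, ← integral_prod _ i1, i2]
      exact ae_eq_zero_of_forall_setIntegral_eq_of_sigmaFinite (fun A hA hA' => (key A hA hA').1)
        fun A hA hA' => (key A hA hA').2
  have : Fact ((2 : ℝ≥0∞) ≠ ⊤) := ⟨by norm_num⟩
  have hzero : ∀ᵐ s : ℝ, ∀ᵐ t : ℝ, G (s, t) = 0 := by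
    -- The exceptional null set depends on `h`; a countable dense family gives one set for all, and
    -- density then kills the slice.
    have hseq : ∀ᵐ s : ℝ, ∀ n : ℕ, ∫ t, G (s, t) * (starRingEnd ℂ)
        (TopologicalSpace.denseSeq (Lp (α := ℝ) ℂ 2 volume) n t) = 0 :=
      ae_all_iff.2 fun n => hslice _
    have hsq : ∀ᵐ s : ℝ, Integrable fun t => ‖G (s, t)‖ ^ 2 :=
      ((memLp_two_iff_integrable_sq_norm hG.1).1 hG).prod_right_ae
    filter_upwards [hseq, hsq] with s h1 h2
    have hm : AEStronglyMeasurable (fun t => G (s, t)) volume :=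
      (hGm.comp_measurable measurable_prodMk_left).aestronglyMeasurable
    have hL : MemLp (fun t => G (s, t)) 2 := (memLp_two_iff_integrable_sq_norm hm).2 h2
    have h3 : ∀ u : Lp (α := ℝ) ℂ 2 volume, inner ℂ u (hL.toLp _) = 0 := fun u => by
      refine (TopologicalSpace.denseRange_denseSeq (Lp (α := ℝ) ℂ 2 volume)).induction_on
        (p := fun u => inner ℂ u (hL.toLp _) = 0) u
        (isClosed_eq (by fun_prop) continuous_const) fun n => ?_
      rw [← h1 n, L2.inner_def]
      refine integral_congr_ae ?_
      filter_upwards [hL.coeFn_toLp] with t ht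
      rw [ht, RCLike.inner_apply]
    have h4 : hL.toLp _ = 0 := inner_self_eq_zero.1 (h3 _)
    filter_upwards [hL.coeFn_toLp, Lp.coeFn_zero ℂ 2 (volume : Measure ℝ)] with t h5 h6
    rw [← h5, h4, h6, Pi.zero_apply]
  have hprod : ∀ᵐ p ∂((volume : Measure ℝ).prod volume), G p = 0 :=
    (Measure.ae_prod_iff_ae_ae (hGm.measurable (measurableSet_singleton 0))).2 hzero
  rw [Lp.eq_zero_iff_ae_eq_zero]
  filter_upwards [measurePreserving_planeEquiv.quasiMeasurePreserving.ae hprod] with z hz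
  rw [← hGv, hz, Pi.zero_apply]

end PlaneTensor

/-! ### The Fourier transform of a product function -/

section FourierTensor

/-- On `L¹ ∩ L²` the `L²` Fourier transform is given by the Fourier integral. -/
theorem coeFn_fourier_toLp {E : Type*} [NormedAddCommGroup E] [InnerProductSpace ℝ E]
    [FiniteDimensional ℝ E] [MeasurableSpace E] [BorelSpace E] {f : E → ℂ} (hf : Integrable f)
    (hf' : MemLp f 2) : (𝓕 (hf'.toLp f) : Lp (α := E) ℂ 2 volume) =ᵐ[volume] 𝓕 f := by
  have hc : Continuous (𝓕 f) :=
    VectorFourier.fourierIntegral_continuous Real.continuous_fourierChar continuous_inner hf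
  -- Both sides are tested against smooth compactly supported `g`: the distributional definition on
  -- the left and the multiplication formula on the right both move `𝓕` onto the test function.
  refine ae_eq_of_integral_contDiff_smul_eq
    ((Lp.memLp (𝓕 (hf'.toLp f))).locallyIntegrable (by norm_num)) hc.locallyIntegrable
    fun g hg hgs => ?_
  have hg' : ContDiff ℝ (⊤ : ℕ∞) fun x => (g x : ℂ) := Complex.ofRealCLM.contDiff.comp hg
  have hgs' : HasCompactSupport fun x => (g x : ℂ) := hgs.comp_left Complex.ofReal_zero
  set φ : SchwartzMap E ℂ := hgs'.toSchwartzMap hg' with hφ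
  have hφv : ∀ x, φ x = (g x : ℂ) := fun x => rfl
  have h1 := congrArg (fun T => T φ) (Lp.fourier_toTemperedDistribution_eq (hf'.toLp f))
  simp only [TemperedDistribution.fourier_apply, Lp.toTemperedDistribution_apply] at h1
  have h2 : ∫ x, (𝓕 φ : SchwartzMap E ℂ) x • hf'.toLp f x = ∫ x, (𝓕 φ : SchwartzMap E ℂ) x • f x := by
    refine integral_congr_ae ?_
    filter_upwards [hf'.coeFn_toLp] with x hx
    rw [hx]
  have h3 : ∫ x, (𝓕 φ : SchwartzMap E ℂ) x • f x = ∫ x, φ x • 𝓕 f x := by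
    simpa using! VectorFourier.integral_fourierIntegral_smul_eq_flip (L := innerₗ E)
      Real.continuous_fourierChar continuous_inner φ.integrable hf
  rw [h2, h3] at h1
  simpa [hφv] using h1.symm

/-- For Schwartz factors the product is integrable, so the Fourier integral is available and Fubini
splits it. -/
theorem fourier_planeTensor_schwartz (φ ψ : SchwartzMap ℝ ℂ) :
    (𝓕 (planeTensor (φ.toLp 2) (ψ.toLp 2)) : Lp (α := EuclideanSpace ℝ (Fin 2)) ℂ 2 volume) =
      planeTensor ((𝓕 φ).toLp 2) ((𝓕 ψ).toLp 2) := by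
  have hL2 := MemLp.coord_mul (φ.memLp 2 volume) (ψ.memLp 2 volume)
  have hL1 := integrable_coord_mul φ.integrable ψ.integrable
  have h1 : planeTensor (φ.toLp 2) (ψ.toLp 2) = hL2.toLp _ := by
    refine Lp.ext ?_
    filter_upwards [coeFn_planeTensor (φ.toLp 2) (ψ.toLp 2), hL2.coeFn_toLp,
      quasiMeasurePreserving_coord_zero.ae (φ.coeFn_toLp 2 volume),
      quasiMeasurePreserving_coord_one.ae (ψ.coeFn_toLp 2 volume)] with z h1 h2 h3 h4
    rw [h1, h2, h3, h4]
  rw [h1]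
  refine Lp.ext ?_
  filter_upwards [coeFn_fourier_toLp hL1 hL2,
    coeFn_planeTensor ((𝓕 φ).toLp 2) ((𝓕 ψ).toLp 2),
    quasiMeasurePreserving_coord_zero.ae ((𝓕 φ).coeFn_toLp 2 volume),
    quasiMeasurePreserving_coord_one.ae ((𝓕 ψ).coeFn_toLp 2 volume)] with z h2 h3 h4 h5
  rw [h2, h3, h4, h5, SchwartzMap.fourier_coe, SchwartzMap.fourier_coe, Real.fourier_eq,
    Real.fourier_eq, Real.fourier_eq, ← integral_coord_mul]
  refine integral_congr_ae (Filter.Eventually.of_forall fun w => ?_)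
  have h6 : -inner ℝ w z = -inner ℝ (w 0) (z 0) + -inner ℝ (w 1) (z 1) := by
    rw [PiLp.inner_apply, Fin.sum_univ_two, neg_add]
  simp only [h6, AddChar.map_add_eq_mul, Circle.smul_def, Circle.coe_mul, smul_eq_mul]
  ring

/-- Density is used in one variable at a time, with the other held fixed. -/
theorem map_bilinear_eq_of_denseRange {D H L : Type*} [NormedAddCommGroup H] [NormedSpace ℂ H]
    [NormedAddCommGroup L] [NormedSpace ℂ L] {d : D → H} (hd : DenseRange d) (β : H →L[ℂ] H →L[ℂ] L)
    {F₁ : H → H} {F₂ : L → L} (hF₁ : Continuous F₁) (hF₂ : Continuous F₂)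
    (hs : ∀ a b, F₂ (β (d a) (d b)) = β (F₁ (d a)) (F₁ (d b))) (f h : H) :
    F₂ (β f h) = β (F₁ f) (F₁ h) := by
  have h2 : ∀ a h, F₂ (β (d a) h) = β (F₁ (d a)) (F₁ h) := fun a h =>
    congrFun (hd.equalizer (hF₂.comp (β (d a)).continuous) ((β (F₁ (d a))).continuous.comp hF₁)
      (funext (hs a))) h
  exact congrFun (hd.equalizer (hF₂.comp (β.flip h).continuous)
    ((β.flip (F₁ h)).continuous.comp hF₁) (funext fun a => h2 a h)) f

/-- The Fourier transform of a product function is the product of the Fourier transforms. -/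
theorem fourier_planeTensor (f h : Lp (α := ℝ) ℂ 2 volume) :
    (𝓕 (planeTensor f h) : Lp (α := EuclideanSpace ℝ (Fin 2)) ℂ 2 volume) =
      planeTensor (𝓕 f) (𝓕 h) := by
  refine map_bilinear_eq_of_denseRange
    (d := fun φ : SchwartzMap ℝ ℂ => (φ.toLp 2 : Lp (α := ℝ) ℂ 2 volume))
    (SchwartzMap.denseRange_toLpCLM (p := 2) ENNReal.ofNat_ne_top) planeTensor
    (F₁ := fun f => (𝓕 f : Lp (α := ℝ) ℂ 2 volume))
    (F₂ := fun f => (𝓕 f : Lp (α := EuclideanSpace ℝ (Fin 2)) ℂ 2 volume))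
    (Lp.fourierTransformₗᵢ ℝ ℂ).continuous
    (Lp.fourierTransformₗᵢ (EuclideanSpace ℝ (Fin 2)) ℂ).continuous (fun φ ψ => ?_) f h
  simp only [SchwartzMap.toLp_fourier_eq]
  exact fourier_planeTensor_schwartz φ ψ

end FourierTensor

/-! ### Products of Paley-Wiener functions -/

section PlanePaleyWiener

/-- A subsequence of the Fourier transforms converges a.e., so vanishing off the band survives.
Completeness is needed for the tensor product model. -/
theorem isClosed_paleyWiener {E : Type*} [NormedAddCommGroup E] [InnerProductSpace ℝ E]
    [FiniteDimensional ℝ E] [MeasurableSpace E] [BorelSpace E] (K : Set E) :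
    IsClosed (paleyWiener K : Set (Lp (α := E) ℂ 2 volume)) := by
  refine IsSeqClosed.isClosed fun u f hu hlim => ?_
  have h1 := ((Lp.fourierTransformₗᵢ E ℂ).continuous.tendsto f).comp hlim
  obtain ⟨ns, -, hns⟩ := (tendstoInMeasure_of_tendsto_Lp h1).exists_seq_tendsto_ae
  have h2 : ∀ᵐ η : E, ∀ n, η ∉ scaledBand K → (𝓕 (u n) : Lp (α := E) ℂ 2 volume) η = 0 :=
    ae_all_iff.2 fun n => mem_paleyWiener_iff.1 (hu n)
  refine mem_paleyWiener_iff.2 ?_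
  filter_upwards [hns, h2] with η h3 h4 hη
  refine tendsto_nhds_unique h3 (tendsto_const_nhds.congr fun n => ?_)
  exact (h4 (ns n) hη).symm

instance {E : Type*} [NormedAddCommGroup E] [InnerProductSpace ℝ E]
    [FiniteDimensional ℝ E] [MeasurableSpace E] [BorelSpace E] (K : Set E) :
    CompleteSpace (paleyWiener K) :=
  (isClosed_paleyWiener K).completeSpace_coe

theorem mem_scaledBand_band₂ {z : EuclideanSpace ℝ (Fin 2)} :
    z ∈ scaledBand band₂ ↔ z 0 ∈ scaledBand band ∧ z 1 ∈ scaledBand band := by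
  simp only [scaledBand, band₂, band, mem_ofPred_eq, Fin.forall_fin_two, PiLp.smul_apply]

theorem band₂_eq_preimage : band₂ = planeEquiv ⁻¹' (band ×ˢ band) := by
  ext z
  simp only [band₂, band, mem_ofPred_eq, Fin.forall_fin_two, mem_preimage, planeEquiv_apply,
    mem_prod]

theorem measurableSet_band₂ : MeasurableSet band₂ := by
  rw [band₂_eq_preimage]
  exact planeEquiv.measurable (measurableSet_band.prod measurableSet_band)

theorem volume_band₂_ne_top : volume band₂ ≠ ⊤ := by
  rw [band₂_eq_preimage, measurePreserving_planeEquiv.measure_preimage_equiv,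
    Measure.volume_eq_prod, Measure.prod_prod]
  exact ENNReal.mul_ne_top volume_band_ne_top volume_band_ne_top

theorem planeTensor_mem_paleyWiener (f h : paleyWiener band) :
    planeTensor (f : Lp (α := ℝ) ℂ 2 volume) (h : Lp (α := ℝ) ℂ 2 volume) ∈ paleyWiener band₂ := by
  rw [mem_paleyWiener_iff, fourier_planeTensor]
  filter_upwards [coeFn_planeTensor (𝓕 (f : Lp (α := ℝ) ℂ 2 volume))
    (𝓕 (h : Lp (α := ℝ) ℂ 2 volume)),
    quasiMeasurePreserving_coord_zero.ae (mem_paleyWiener_iff.1 f.2),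
    quasiMeasurePreserving_coord_one.ae (mem_paleyWiener_iff.1 h.2)] with z h1 h2 h3 hz
  rw [h1]
  rw [mem_scaledBand_band₂, not_and_or] at hz
  rcases hz with hz | hz
  · rw [h2 hz, zero_mul]
  · rw [h3 hz, mul_zero]

/-- The bilinear map sending `f, h ∈ PW` to `(s, t) ↦ f s * h t` in `PW⁽²⁾`. -/
def paleyWienerTensor : paleyWiener band →ₗ[ℂ] paleyWiener band →ₗ[ℂ] paleyWiener band₂ :=
  LinearMap.mk₂ ℂ (fun f h => ⟨planeTensor f h, planeTensor_mem_paleyWiener f h⟩)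
    (fun f f' h => Subtype.ext (by simp)) (fun c f h => Subtype.ext (by simp))
    (fun f h h' => Subtype.ext (by simp)) (fun c f h => Subtype.ext (by simp))

theorem coe_paleyWienerTensor (f h : paleyWiener band) :
    (paleyWienerTensor f h : Lp (α := EuclideanSpace ℝ (Fin 2)) ℂ 2 volume) = planeTensor f h :=
  rfl

/-- The band-limited part of an `L²` function, taken on the Fourier side. -/
theorem exists_bandLimited (f : Lp (α := ℝ) ℂ 2 volume) : ∃ g : paleyWiener band,
    ∀ᵐ η, (𝓕 (g : Lp (α := ℝ) ℂ 2 volume) : Lp (α := ℝ) ℂ 2 volume) η =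
      (scaledBand band).indicator f η := by
  have hm := (Lp.memLp f).indicator (measurableSet_scaledBand measurableSet_band)
  have h1 : (𝓕 (𝓕⁻ (hm.toLp _) : Lp (α := ℝ) ℂ 2 volume) : Lp (α := ℝ) ℂ 2 volume) =
    hm.toLp _ := FourierTransform.fourier_fourierInv_eq _
  refine ⟨⟨𝓕⁻ (hm.toLp _), ?_⟩, ?_⟩
  · rw [mem_paleyWiener_iff, h1]
    filter_upwards [hm.coeFn_toLp] with η h2 h3
    rw [h2, indicator_of_notMem h3]
  · rw [h1]
    exact hm.coeFn_toLp

/-- Against a function supported on the square, truncating the factors to the band changes nothing.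
-/
theorem inner_planeTensor_indicator {f h f' h' : Lp (α := ℝ) ℂ 2 volume}
    (hf : ∀ᵐ η, f' η = (scaledBand band).indicator f η)
    (hh : ∀ᵐ η, h' η = (scaledBand band).indicator h η)
    {V : Lp (α := EuclideanSpace ℝ (Fin 2)) ℂ 2 volume}
    (hV : ∀ᵐ z, z ∉ scaledBand band₂ → V z = 0) :
    inner ℂ (planeTensor f h) V = inner ℂ (planeTensor f' h') V := by
  rw [L2.inner_def, L2.inner_def]
  refine integral_congr_ae ?_
  filter_upwards [coeFn_planeTensor f h, coeFn_planeTensor f' h',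
    quasiMeasurePreserving_coord_zero.ae hf, quasiMeasurePreserving_coord_one.ae hh, hV]
    with z h2 h3 h4 h5 h6
  rw [h2, h3, h4, h5]
  by_cases hz : z ∈ scaledBand band₂
  · rw [mem_scaledBand_band₂] at hz
    rw [indicator_of_mem hz.1, indicator_of_mem hz.2]
  · rw [h6 hz, inner_zero_right, inner_zero_right]

/-- By Plancherel and truncation, orthogonality of `v` to band-limited products becomes
orthogonality of `𝓕 v` to all products, which are total in `L²(ℝ²)`. -/
theorem eq_zero_of_inner_paleyWienerTensor (v : paleyWiener band₂)
    (hv : ∀ f h, inner ℂ (paleyWienerTensor f h) v = 0) : v = 0 := by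
  obtain ⟨v, hvm⟩ := v
  have h0 : (𝓕 v : Lp (α := EuclideanSpace ℝ (Fin 2)) ℂ 2 volume) = 0 := by
    refine eq_zero_of_inner_planeTensor _ fun f h => ?_
    obtain ⟨f', hf'⟩ := exists_bandLimited f
    obtain ⟨h', hh'⟩ := exists_bandLimited h
    rw [inner_planeTensor_indicator hf' hh' (mem_paleyWiener_iff.1 hvm), ← fourier_planeTensor,
      Lp.inner_fourier_eq]
    exact hv f' h'
  refine Subtype.ext ((Lp.fourierTransformₗᵢ (EuclideanSpace ℝ (Fin 2)) ℂ).injective ?_)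
  exact h0.trans (map_zero _).symm

theorem windowFun_plane (s t : ℝ) (z : EuclideanSpace ℝ (Fin 2)) :
    windowFun band₂ !₂[s, t] z = windowFun band s (z 0) * windowFun band t (z 1) := by
  classical
  simp only [windowFun, indicator_apply, mem_scaledBand_band₂]
  by_cases h0 : z 0 ∈ scaledBand band <;> by_cases h1 : z 1 ∈ scaledBand band <;>
    simp only [h0, h1, and_self, and_true, true_and, if_true, if_false, mul_zero, zero_mul]
  rw [← Complex.exp_add, PiLp.inner_apply, Fin.sum_univ_two]
  congr 1
  simp
  ring

/-- Point evaluation as a continuous functional on the Paley-Wiener space. -/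
theorem exists_pointValueCLM {E : Type*} [NormedAddCommGroup E] [InnerProductSpace ℝ E]
    [FiniteDimensional ℝ E] [MeasurableSpace E] [BorelSpace E] {K : Set E} (hK : MeasurableSet K)
    (hv : volume K ≠ ⊤) (t : E) :
    ∃ L : paleyWiener K →L[ℂ] ℂ, ∀ f, L f = pointValue f t :=
  ⟨innerSL ℂ ((memLp_windowFun hK hv t).toLp _) ∘L
    ((Lp.fourierTransformₗᵢ E ℂ).toContinuousLinearEquiv :
      Lp (α := E) ℂ 2 volume →L[ℂ] Lp (α := E) ℂ 2 volume) ∘L (paleyWiener K).subtypeL, fun f => (pointValue_eq_inner hK hv f t).symm⟩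

/-- The window function factors, hence so does the inner product representing evaluation. The
identity holds at every point, as sampling requires, and not merely a.e. -/
theorem pointValue_paleyWienerTensor (f h : paleyWiener band) (s t : ℝ) :
    pointValue (paleyWienerTensor f h) !₂[s, t] = pointValue f s * pointValue h t := by
  rw [pointValue_eq_inner measurableSet_band₂ volume_band₂_ne_top,
    pointValue_eq_inner measurableSet_band volume_band_ne_top,
    pointValue_eq_inner measurableSet_band volume_band_ne_top, ← inner_planeTensor,
    coe_paleyWienerTensor, fourier_planeTensor]
  congr 1
  refine Lp.ext ?_
  have hw := fun t => (memLp_windowFun measurableSet_band volume_band_ne_top t).coeFn_toLp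
  filter_upwards [coeFn_planeTensor
    ((memLp_windowFun measurableSet_band volume_band_ne_top s).toLp _)
    ((memLp_windowFun measurableSet_band volume_band_ne_top t).toLp _),
    (memLp_windowFun measurableSet_band₂ volume_band₂_ne_top !₂[s, t]).coeFn_toLp,
    quasiMeasurePreserving_coord_zero.ae (hw s),
    quasiMeasurePreserving_coord_one.ae (hw t)] with z h1 h2 h3 h4
  rw [h1, h2, h3, h4, windowFun_plane]

end PlanePaleyWiener

/-! ### Double sequences as a Hilbert tensor product -/

section SequenceTensor

variable {ι κ : Type*}

theorem memℓp_mul (a : lp (fun _ : ι => ℂ) 2) (b : lp (fun _ : κ => ℂ) 2) :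
    Memℓp (fun p : ι × κ => a p.1 * b p.2) 2 := by
  refine memℓp_gen ?_
  have h := Summable.mul_of_nonneg (hasSum_norm_sq a).summable (hasSum_norm_sq b).summable
    (fun _ => by positivity) fun _ => by positivity
  refine h.congr fun p => ?_
  simp [mul_pow]

/-- The bilinear map sending sequences `a, b` to the double sequence `a i * b j`. -/
def sequenceTensor : lp (fun _ : ι => ℂ) 2 →ₗ[ℂ] lp (fun _ : κ => ℂ) 2 →ₗ[ℂ]
    lp (fun _ : ι × κ => ℂ) 2 :=
  LinearMap.mk₂ ℂ (fun a b => ⟨fun p => a p.1 * b p.2, memℓp_mul a b⟩)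
    (fun _ _ _ => lp.ext (funext fun _ => add_mul _ _ _))
    (fun _ _ _ => lp.ext (funext fun _ => mul_assoc _ _ _))
    (fun _ _ _ => lp.ext (funext fun _ => mul_add _ _ _))
    (fun _ _ _ => lp.ext (funext fun _ => mul_left_comm _ _ _))

theorem sequenceTensor_apply (a : lp (fun _ : ι => ℂ) 2) (b : lp (fun _ : κ => ℂ) 2) (p : ι × κ) :
    sequenceTensor a b p = a p.1 * b p.2 := rfl

theorem sequenceTensor_single [DecidableEq ι] [DecidableEq κ] (p : ι × κ) :
    sequenceTensor (lp.single 2 p.1 (1 : ℂ)) (lp.single 2 p.2 (1 : ℂ)) = lp.single 2 p (1 : ℂ) := by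
  ext q
  rw [sequenceTensor_apply]
  simp only [lp.single_apply, Pi.single_apply, Prod.ext_iff]
  split_ifs <;> simp_all

theorem inner_sequenceTensor (a a' : lp (fun _ : ι => ℂ) 2) (b b' : lp (fun _ : κ => ℂ) 2) :
    inner ℂ (sequenceTensor a b) (sequenceTensor a' b') = inner ℂ a a' * inner ℂ b b' := by
  have hs : (fun p : ι × κ => inner ℂ (sequenceTensor a b p) (sequenceTensor a' b' p)) =
      fun p => inner ℂ (a p.1) (a' p.1) * inner ℂ (b p.2) (b' p.2) := funext fun p => by
    rw [sequenceTensor_apply, sequenceTensor_apply, RCLike.inner_apply, RCLike.inner_apply,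
      RCLike.inner_apply, map_mul]
    ring
  have hab : HasSum (fun p : ι × κ => inner ℂ (a p.1) (a' p.1) * inner ℂ (b p.2) (b' p.2))
      (inner ℂ (sequenceTensor a b) (sequenceTensor a' b')) :=
    hs ▸ lp.hasSum_inner (𝕜 := ℂ) (sequenceTensor a b) (sequenceTensor a' b')
  have ha := lp.hasSum_inner (𝕜 := ℂ) a a'
  have hb := lp.hasSum_inner (𝕜 := ℂ) b b'
  exact (ha.mul_eq hb hab).symm

theorem eq_zero_of_inner_sequenceTensor (v : lp (fun _ : ι × κ => ℂ) 2)
    (hv : ∀ a b, inner ℂ (sequenceTensor a b) v = 0) : v = 0 := by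
  classical
  ext p
  have h := hv (lp.single 2 p.1 1) (lp.single 2 p.2 1)
  rw [sequenceTensor_single, lp.inner_single_left] at h
  simpa using h

end SequenceTensor

/-! ### Factorisation over the grid -/

section Grid

theorem IsRieszBasisSequence.summable_norm_sq_gaussian {x : ℤ → ℝ} (hx : IsRieszBasisSequence x)
    {lam : ℝ} (hlam : 0 < lam) (t : ℝ) : Summable fun j => ‖gaussian lam (t - x j)‖ ^ 2 := by
  simp_rw [norm_sq_gaussian_real]
  exact hx.summable_gaussian (by positivity) t

/-- Squared Euclidean norms add over coordinates; this is the property of the kernel that makes the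
grid problem split. -/
theorem gaussian_plane (lam s t : ℝ) (z : EuclideanSpace ℝ (Fin 2)) :
    gaussian lam (z - !₂[s, t]) = gaussian lam (z 0 - s) * gaussian lam (z 1 - t) := by
  rw [gaussian_real, gaussian_real, gaussian, EuclideanSpace.norm_sq_eq, Fin.sum_univ_two,
    ← Complex.ofReal_mul, ← Real.exp_add]
  simp
  ring_nf

theorem hilbertTensorMap_comp_symm {H K V W : Type*}
    [NormedAddCommGroup H] [InnerProductSpace ℂ H] [NormedAddCommGroup K] [InnerProductSpace ℂ K]
    [NormedAddCommGroup V] [InnerProductSpace ℂ V] [NormedAddCommGroup W] [InnerProductSpace ℂ W]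
    (S : H ≃L[ℂ] V) (T : K ≃L[ℂ] W) (u : HilbertTensor H K) :
    hilbertTensorMap (S.symm : V →L[ℂ] H) (T.symm : W →L[ℂ] K)
      (hilbertTensorMap (S : H →L[ℂ] V) (T : K →L[ℂ] W) u) = u := by
  have h : hilbertTensorMap (S.symm : V →L[ℂ] H) (T.symm : W →L[ℂ] K) ∘L
      hilbertTensorMap (S : H →L[ℂ] V) (T : K →L[ℂ] W) = ContinuousLinearMap.id ℂ _ :=
    hilbertTensor_ext fun h k => by simp [hilbertTensorMap_pureTensor]
  exact congrArg (fun f => f u) h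

/-- The Hilbert tensor product of two invertible operators. -/
def hilbertTensorCongr {H K V W : Type*}
    [NormedAddCommGroup H] [InnerProductSpace ℂ H] [NormedAddCommGroup K] [InnerProductSpace ℂ K]
    [NormedAddCommGroup V] [InnerProductSpace ℂ V] [NormedAddCommGroup W] [InnerProductSpace ℂ W]
    (S : H ≃L[ℂ] V) (T : K ≃L[ℂ] W) : HilbertTensor H K ≃L[ℂ] HilbertTensor V W :=
  ContinuousLinearEquiv.equivOfInverse
    (hilbertTensorMap (S : H →L[ℂ] V) (T : K →L[ℂ] W))
    (hilbertTensorMap (S.symm : V →L[ℂ] H) (T.symm : W →L[ℂ] K))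
    (hilbertTensorMap_comp_symm S T) fun u => by
      simpa using hilbertTensorMap_comp_symm S.symm T.symm u

/-- The interpolation operator of a Riesz-basis sequence is well defined. -/
theorem IsRieszBasisSequence.isGaussianInterpolationOperator {x : ℤ → ℝ}
    (hx : IsRieszBasisSequence x) {lam : ℝ} (hlam : 0 < lam) :
    IsGaussianInterpolationOperator band lam x (gaussianInterpolationOperator band lam x) := by
  obtain ⟨A, hA⟩ := hx.exists_interpolation_matrix hlam
  obtain ⟨P, hP⟩ := hx.exists_sampling
  obtain ⟨S, hS⟩ := hx.exists_gaussian_synthesis hlam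
  exact (isGaussianInterpolationOperator_comp A hA P hP S hS
    (hx.summable_norm_sq_gaussian hlam)).isGaussianInterpolationOperator

theorem exists_paleyWiener_equiv :
    ∃ Φ : HilbertTensor (paleyWiener band) (paleyWiener band) ≃ₗᵢ[ℂ] paleyWiener band₂,
      ∀ f h, Φ (pureTensor f h) = paleyWienerTensor f h :=
  exists_hilbertTensor_equiv paleyWienerTensor
    (fun f h f' h' => inner_planeTensor f h f' h') eq_zero_of_inner_paleyWienerTensor

theorem exists_plane_equiv :
    ∃ Ψ : HilbertTensor (Lp (α := ℝ) ℂ 2 volume) (Lp (α := ℝ) ℂ 2 volume) ≃ₗᵢ[ℂ]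
        Lp (α := EuclideanSpace ℝ (Fin 2)) ℂ 2 volume,
      ∀ f h, Ψ (pureTensor f h) = planeTensor f h :=
  exists_hilbertTensor_equiv planeTensor.toLinearMap₁₂ inner_planeTensor
    eq_zero_of_inner_planeTensor

theorem exists_sequence_equiv (ι κ : Type*) :
    ∃ Θ : HilbertTensor (lp (fun _ : ι => ℂ) 2) (lp (fun _ : κ => ℂ) 2) ≃ₗᵢ[ℂ]
        lp (fun _ : ι × κ => ℂ) 2,
      ∀ a b, Θ (pureTensor a b) = sequenceTensor a b :=
  exists_hilbertTensor_equiv sequenceTensor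
    (fun a b a' b' => inner_sequenceTensor a a' b b') eq_zero_of_inner_sequenceTensor

theorem symm_single_of_sequenceTensor
    {Θ : HilbertTensor (lp (fun _ : ℤ => ℂ) 2) (lp (fun _ : ℤ => ℂ) 2) ≃ₗᵢ[ℂ]
      lp (fun _ : ℤ × ℤ => ℂ) 2} (hΘ : ∀ a b, Θ (pureTensor a b) = sequenceTensor a b)
    (q : ℤ × ℤ) :
    Θ.symm (lp.single 2 q 1) = pureTensor (lp.single 2 q.1 1) (lp.single 2 q.2 1) := by
  rw [LinearIsometryEquiv.symm_apply_eq, hΘ, sequenceTensor_single]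

/-- The interpolation matrix of a grid is the tensor product of the two interpolation matrices. -/
theorem interpolation_matrix_grid
    {Θ : HilbertTensor (lp (fun _ : ℤ => ℂ) 2) (lp (fun _ : ℤ => ℂ) 2) ≃ₗᵢ[ℂ]
      lp (fun _ : ℤ × ℤ => ℂ) 2} (hΘ : ∀ a b, Θ (pureTensor a b) = sequenceTensor a b)
    {x y : ℤ → ℝ} {lam : ℝ} {A A' : lp (fun _ : ℤ => ℂ) 2 →L[ℂ] lp (fun _ : ℤ => ℂ) 2}
    (hA : ∀ j k, A (lp.single 2 j 1) k = gaussian lam (x k - x j))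
    (hA' : ∀ j k, A' (lp.single 2 j 1) k = gaussian lam (y k - y j)) (q p : ℤ × ℤ) :
    Θ (hilbertTensorMap A A' (Θ.symm (lp.single 2 q 1))) p =
      gaussian lam (grid x y p - grid x y q) := by
  rw [symm_single_of_sequenceTensor hΘ, hilbertTensorMap_pureTensor, hΘ, sequenceTensor_apply, hA,
    hA', grid, grid, gaussian_plane]
  rfl

set_option maxHeartbeats 1000000 in
/-- Sampling on a grid is the tensor product of the two sampling operators. -/
theorem sampling_grid
    {Θ : HilbertTensor (lp (fun _ : ℤ => ℂ) 2) (lp (fun _ : ℤ => ℂ) 2) ≃ₗᵢ[ℂ]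
      lp (fun _ : ℤ × ℤ => ℂ) 2} (hΘ : ∀ a b, Θ (pureTensor a b) = sequenceTensor a b)
    {Φ : HilbertTensor (paleyWiener band) (paleyWiener band) ≃ₗᵢ[ℂ] paleyWiener band₂}
    (hΦ : ∀ f h, Φ (pureTensor f h) = paleyWienerTensor f h)
    {x y : ℤ → ℝ} {P P' : paleyWiener band →L[ℂ] lp (fun _ : ℤ => ℂ) 2}
    (hP : ∀ f k, P f k = pointValue f (x k)) (hP' : ∀ f k, P' f k = pointValue f (y k))
    (u : HilbertTensor (paleyWiener band) (paleyWiener band)) (p : ℤ × ℤ) :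
    Θ (hilbertTensorMap P P' u) p = pointValue (Φ u) (grid x y p) := by
  obtain ⟨L, hL⟩ := exists_pointValueCLM measurableSet_band₂ volume_band₂_ne_top (grid x y p)
  -- Both sides are continuous in `u`, so elementary tensors suffice.
  have h : lp.evalCLM ℂ (fun _ : ℤ × ℤ => ℂ) 2 p ∘L
      (Θ.toContinuousLinearEquiv : _ →L[ℂ] _) ∘L hilbertTensorMap P P' =
      L ∘L (Φ.toContinuousLinearEquiv : _ →L[ℂ] _) := hilbertTensor_ext fun f h => by
    show Θ (hilbertTensorMap P P' (pureTensor f h)) p = L (Φ (pureTensor f h))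
    rw [hilbertTensorMap_pureTensor, hΘ, sequenceTensor_apply, hΦ, hL, grid,
      pointValue_paleyWienerTensor, hP, hP']
  rw [← hL]
  exact congrArg (fun f => f u) h

/-- Gaussian synthesis on a grid is the tensor product of the two synthesis operators. -/
theorem gaussian_synthesis_grid
    {Θ : HilbertTensor (lp (fun _ : ℤ => ℂ) 2) (lp (fun _ : ℤ => ℂ) 2) ≃ₗᵢ[ℂ]
      lp (fun _ : ℤ × ℤ => ℂ) 2} (hΘ : ∀ a b, Θ (pureTensor a b) = sequenceTensor a b)
    {Ψ : HilbertTensor (Lp (α := ℝ) ℂ 2 volume) (Lp (α := ℝ) ℂ 2 volume) ≃ₗᵢ[ℂ]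
      Lp (α := EuclideanSpace ℝ (Fin 2)) ℂ 2 volume}
    (hΨ : ∀ f h, Ψ (pureTensor f h) = planeTensor f h)
    {x y : ℤ → ℝ} {lam : ℝ} {S S' : lp (fun _ : ℤ => ℂ) 2 →L[ℂ] Lp (α := ℝ) ℂ 2 volume}
    (hS : ∀ j, S (lp.single 2 j 1) =ᵐ[volume] fun t => gaussian lam (t - x j))
    (hS' : ∀ j, S' (lp.single 2 j 1) =ᵐ[volume] fun t => gaussian lam (t - y j)) (q : ℤ × ℤ) :
    Ψ (hilbertTensorMap S S' (Θ.symm (lp.single 2 q 1))) =ᵐ[volume]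
      fun t => gaussian lam (t - grid x y q) := by
  rw [symm_single_of_sequenceTensor hΘ, hilbertTensorMap_pureTensor, hΨ]
  filter_upwards [coeFn_planeTensor (S (lp.single 2 q.1 1)) (S' (lp.single 2 q.2 1)),
    quasiMeasurePreserving_coord_zero.ae (hS q.1),
    quasiMeasurePreserving_coord_one.ae (hS' q.2)] with z h1 h2 h3
  rw [h1, h2, h3, grid, gaussian_plane]

theorem summable_norm_sq_gaussian_grid {x y : ℤ → ℝ} (hx : IsRieszBasisSequence x)
    (hy : IsRieszBasisSequence y) {lam : ℝ} (hlam : 0 < lam) (t : EuclideanSpace ℝ (Fin 2)) :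
    Summable fun q => ‖gaussian lam (t - grid x y q)‖ ^ 2 := by
  have h := Summable.mul_of_nonneg (f := fun l => ‖gaussian lam (t 0 - x l)‖ ^ 2)
    (g := fun k => ‖gaussian lam (t 1 - y k)‖ ^ 2) (hx.summable_norm_sq_gaussian hlam (t 0))
    (hy.summable_norm_sq_gaussian hlam (t 1)) (fun _ => by positivity) fun _ => by positivity
  refine h.congr fun q => ?_
  rw [grid, gaussian_plane, norm_mul, mul_pow]

set_option maxHeartbeats 1000000 in
/-- The tensor product of two interpolation operators is an interpolation operator for the grid. -/
theorem isGaussianInterpolationOperator_grid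
    {Φ : HilbertTensor (paleyWiener band) (paleyWiener band) ≃ₗᵢ[ℂ] paleyWiener band₂}
    (hΦ : ∀ f h, Φ (pureTensor f h) = paleyWienerTensor f h)
    {Ψ : HilbertTensor (Lp (α := ℝ) ℂ 2 volume) (Lp (α := ℝ) ℂ 2 volume) ≃ₗᵢ[ℂ]
      Lp (α := EuclideanSpace ℝ (Fin 2)) ℂ 2 volume}
    (hΨ : ∀ f h, Ψ (pureTensor f h) = planeTensor f h)
    {x y : ℤ → ℝ} (hx : IsRieszBasisSequence x) (hy : IsRieszBasisSequence y)
    {lam : ℝ} (hlam : 0 < lam) {T T' : paleyWiener band →L[ℂ] Lp (α := ℝ) ℂ 2 volume}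
    (hT : IsGaussianInterpolationOperator band lam x T)
    (hT' : IsGaussianInterpolationOperator band lam y T') :
    IsGaussianInterpolationOperator band₂ lam (grid x y)
      ((Ψ.toContinuousLinearEquiv : _ →L[ℂ] _) ∘L hilbertTensorMap T T' ∘L
        (Φ.symm.toContinuousLinearEquiv :
          paleyWiener band₂ →L[ℂ] HilbertTensor (paleyWiener band) (paleyWiener band))) := by
  obtain ⟨A, hA⟩ := hx.exists_interpolation_matrix hlam
  obtain ⟨A', hA'⟩ := hy.exists_interpolation_matrix hlam
  obtain ⟨P, hP⟩ := hx.exists_sampling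
  obtain ⟨P', hP'⟩ := hy.exists_sampling
  obtain ⟨S, hS⟩ := hx.exists_gaussian_synthesis hlam
  obtain ⟨S', hS'⟩ := hy.exists_gaussian_synthesis hlam
  obtain ⟨Θ, hΘ⟩ := exists_sequence_equiv ℤ ℤ
  have hTeq := hT.unique (isGaussianInterpolationOperator_comp A hA P hP S hS
    (hx.summable_norm_sq_gaussian hlam))
  have hTeq' := hT'.unique (isGaussianInterpolationOperator_comp A' hA' P' hP' S' hS'
    (hy.summable_norm_sq_gaussian hlam))
  -- The grid matrix is `A ⊗ₕ A'` transported by `Θ`; its inverse comes from `A⁻¹ ⊗ₕ A'⁻¹`.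
  let A₂ : lp (fun _ : ℤ × ℤ => ℂ) 2 ≃L[ℂ] lp (fun _ : ℤ × ℤ => ℂ) 2 :=
    Θ.symm.toContinuousLinearEquiv.trans
      ((hilbertTensorCongr A A').trans Θ.toContinuousLinearEquiv)
  let P₂ : paleyWiener band₂ →L[ℂ] lp (fun _ : ℤ × ℤ => ℂ) 2 :=
    (Θ.toContinuousLinearEquiv : _ →L[ℂ] _) ∘L hilbertTensorMap P P' ∘L
      (Φ.symm.toContinuousLinearEquiv :
        paleyWiener band₂ →L[ℂ] HilbertTensor (paleyWiener band) (paleyWiener band))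
  let S₂ : lp (fun _ : ℤ × ℤ => ℂ) 2 →L[ℂ] Lp (α := EuclideanSpace ℝ (Fin 2)) ℂ 2 volume :=
    (Ψ.toContinuousLinearEquiv : _ →L[ℂ] _) ∘L hilbertTensorMap S S' ∘L
      (Θ.symm.toContinuousLinearEquiv : _ →L[ℂ] _)
  have hP₂ : ∀ F p, P₂ F p = pointValue F (grid x y p) := fun F p => by
    have h := sampling_grid hΘ hΦ hP hP' (Φ.symm F) p
    rw [Φ.apply_symm_apply] at h
    exact h
  have hI := isGaussianInterpolationOperator_comp A₂ (interpolation_matrix_grid hΘ hA hA') P₂ hP₂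
    S₂ (gaussian_synthesis_grid hΘ hΨ hS hS')
    (summable_norm_sq_gaussian_grid hx hy hlam)
  have hcomp : hilbertTensorMap T T' = hilbertTensorMap S S' ∘L
      hilbertTensorMap (A.symm : _ →L[ℂ] _) (A'.symm : _ →L[ℂ] _) ∘L hilbertTensorMap P P' := by
    rw [hTeq, hTeq']
    exact hilbertTensor_ext fun f h => by
      simp only [ContinuousLinearMap.comp_apply, hilbertTensorMap_pureTensor]
  -- In the composite of the three grid factors the inner copies of `Θ` cancel, leaving `hcomp`.
  have hF : ∀ F, Ψ (hilbertTensorMap T T' (Φ.symm F)) = S₂ (A₂.symm (P₂ F)) := fun F => by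
    rw [hcomp]
    show _ = Ψ (hilbertTensorMap S S' (Θ.symm (Θ (hilbertTensorMap (A.symm : _ →L[ℂ] _)
      (A'.symm : _ →L[ℂ] _) (Θ.symm (Θ (hilbertTensorMap P P' (Φ.symm F))))))))
    rw [Θ.symm_apply_apply, Θ.symm_apply_apply]
    rfl
  have hop : (Ψ.toContinuousLinearEquiv : _ →L[ℂ] _) ∘L hilbertTensorMap T T' ∘L
      (Φ.symm.toContinuousLinearEquiv :
        paleyWiener band₂ →L[ℂ] HilbertTensor (paleyWiener band) (paleyWiener band)) =
      S₂ ∘L (A₂.symm : lp (fun _ : ℤ × ℤ => ℂ) 2 →L[ℂ] lp (fun _ : ℤ × ℤ => ℂ) 2) ∘L P₂ :=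
    ContinuousLinearMap.ext hF
  rw [hop]
  exact hI

end Grid

end GaussianInterpolation

end

/-! ### The proposition -/

open GaussianInterpolation
set_option maxHeartbeats 400000 in
theorem propositionP (x y : ℤ → ℝ) (hx : IsRieszBasisSequence x) (hy : IsRieszBasisSequence y)
    (lam : ℝ) (hlam : 0 < lam) :
    -- the three interpolation operators are well defined
    IsGaussianInterpolationOperator band lam x (gaussianInterpolationOperator band lam x) ∧
    IsGaussianInterpolationOperator band lam y (gaussianInterpolationOperator band lam y) ∧
    IsGaussianInterpolationOperator band₂ lam (grid x y)
      (gaussianInterpolationOperator band₂ lam (grid x y)) ∧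
    -- under the identifications of `PW ⊗ₕ PW` with `PW⁽²⁾` and of `L²(ℝ) ⊗ₕ L²(ℝ)` with `L²(ℝ²)`,
    -- both sending `f ⊗ h` to `(s, t) ↦ f s * h t`, the planar operator is the tensor product
    ∃ (Φ : HilbertTensor (paleyWiener band) (paleyWiener band) ≃ₗᵢ[ℂ] paleyWiener band₂)
      (Ψ : HilbertTensor (Lp (α := ℝ) ℂ 2 volume) (Lp (α := ℝ) ℂ 2 volume) ≃ₗᵢ[ℂ]
        Lp (α := EuclideanSpace ℝ (Fin 2)) ℂ 2 volume),
      (∀ f h : paleyWiener band, ∀ᵐ z : EuclideanSpace ℝ (Fin 2),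
        (Φ (pureTensor f h) : Lp (α := EuclideanSpace ℝ (Fin 2)) ℂ 2 volume) z =
          (f : Lp (α := ℝ) ℂ 2 volume) (z 0) * (h : Lp (α := ℝ) ℂ 2 volume) (z 1)) ∧
      (∀ f h : Lp (α := ℝ) ℂ 2 volume, ∀ᵐ z : EuclideanSpace ℝ (Fin 2),
        Ψ (pureTensor f h) z = f (z 0) * h (z 1)) ∧
      ∀ F : paleyWiener band₂,
        gaussianInterpolationOperator band₂ lam (grid x y) F =
          Ψ (hilbertTensorMap (gaussianInterpolationOperator band lam x)
            (gaussianInterpolationOperator band lam y) (Φ.symm F)) := by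
  obtain ⟨Φ, hΦ⟩ := exists_paleyWiener_equiv
  obtain ⟨Ψ, hΨ⟩ := exists_plane_equiv
  have hI := hx.isGaussianInterpolationOperator hlam
  have hI' := hy.isGaussianInterpolationOperator hlam
  -- The tensor product operator solves the grid problem; it proves the planar operator well defined
  -- and, by uniqueness, equals it.
  have hI₂ := isGaussianInterpolationOperator_grid hΦ hΨ hx hy hlam hI hI'
  refine ⟨hI, hI', hI₂.isGaussianInterpolationOperator, Φ, Ψ, fun f h => ?_, fun f h => ?_,
    fun F => ?_⟩
  · rw [hΦ]
    exact coeFn_planeTensor f h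
  · rw [hΨ]
    exact coeFn_planeTensor f h
  · exact DFunLike.congr_fun (hI₂.isGaussianInterpolationOperator.unique hI₂) F
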